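/- Let $n\in\mathbb N$, $\alpha\in(0,1)$, $t_0\le t_*<\vartheta$, $A\in L^\infty([t_0,\vartheta],\mathbb R^{n\times n})$ and $b\in L^\infty([t_0,\vartheta],\mathbb R^n)$. For $\beta>0$ let $(I^{\beta}_{a+}\varphi)(t)=\frac1{\Gamma(\beta)}\int_a^t\frac{\varphi(\tau)}{(t-\tau)^{1-\beta}}\,d\tau$, and let the Caputo derivative be $({}^C\!D^\alpha_{a+}x)(t)=\frac{d}{dt}\bigl(I^{1-\alpha}_{a+}(x(\cdot)-x(a))\bigr)(t)$. Write $x\in AC^\alpha([a,b],\mathbb R^n)$ if there is $\varphi\in L^\infty([a,b],\mathbb R^n)$ with $x(t)=x(a)+(I^\alpha_{a+}\varphi)(t)$ for all $t\in[a,b]$. Let $w_*\in AC^\alpha([t_0,t_*],\mathbb R^n)$. A function $x\in AC^\alpha([t_0,\vartheta],\mathbb R^n)$ is a solution of the Cauchy problem if $x(t)=w_*(t)$ for all $t\in[t_0,t_*]$ and $({}^C\!D^\alpha_{t_0+}x)(t)$ exists and equals $A(t)x(t)+b(t)$ for almost every $t\in[t_*,\vartheta]$. A fundamental solution matrix is a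 function $F(t,s)\in\mathbb R^{n\times n}$, $t_0\le s\le t\le\vartheta$, such that for every $s\in[t_0,\vartheta]$ the function $F(\cdot,s)$ is continuous on $[s,\vartheta]$ and satisfies there $$F(t,s)=\frac{\mathrm{Id}}{\Gamma(\alpha)}+\frac{(t-s)^{1-\alpha}}{\Gamma(\alpha)}\int_s^t\frac{A(\tau)F(\tau,s)}{(t-\tau)^{1-\alpha}(\tau-s)^{1-\alpha}}\,d\tau .$$ Then there is exactly one fundamental solution matrix $F$, there is exactly one solution $x$ of the Cauchy problem, and for every $t\in[t_*,\vartheta]$ the integrals over $[t_*,t]$ below converge absolutely and $$x(t)=\Bigl(\mathrm{Id}+\int_{t_*}^t\frac{F(t,\tau)A(\tau)}{(t-\tau)^{1-\alpha}}\,d\tau\Bigr)w_*(t_*)+\int_{t_*}^t\frac{F(t,\tau)\,b_*(\tau)}{(t-\tau)^{1-\alpha}}\,d\tau ,$$ where, for $t\in(t_*,\vartheta]$, $$b_*(t)=\frac{\alpha}{\Gamma(1-\alpha)}\int_{t_0}^{t_*}\frac{w_*(\tau)-w_*(t_0)}{(t-\tau)^{1+\alpha}}\,d\tau-\frac{w_*(t_*)-w_*(t_0)}{\Gamma(1-\alpha)(t-t_*)^{\alpha}}+b(t).$$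 -/

import Mathlib

open MeasureTheory Set
open scoped Matrix ENNReal

/- Vectors carry the sup norm of `Fin n → ℝ`, matrices the corresponding operator norm. -/
attribute [local instance] Matrix.linftyOpNormedAddCommGroup Matrix.linftyOpNormedSpace

namespace CaputoLinear

noncomputable section

/-- `φ ∈ L^∞([a, b], X)`: Lebesgue measurable and essentially bounded on `[a, b]`
(no condition if `a = b`). -/
def IsLinf {X : Type*} [NormedAddCommGroup X] (a b : ℝ) (φ : ℝ → X) : Prop :=
  MemLp φ ∞ (volume.restrict (Icc a b))

/-- `φ ∈ C([a, b], X)`, in the topology of the norm. -/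
def IsCont {X : Type*} [NormedAddCommGroup X] (a b : ℝ) (φ : ℝ → X) : Prop :=
  ContinuousOn φ (Icc a b)

/-- `φ` is Lebesgue integrable between `a` and `b`. -/
def IsInt {X : Type*} [NormedAddCommGroup X] (a b : ℝ) (φ : ℝ → X) : Prop :=
  IntervalIntegrable φ volume a b

/-- The left-sided Riemann–Liouville fractional integral
`(I^β_{a+} φ)(t) = (1 / Γ(β)) ∫_a^t φ(τ) (t - τ)^(β - 1) dτ`. -/
def rlIntegral {X : Type*} [NormedAddCommGroup X] [NormedSpace ℝ X]
    (β a : ℝ) (φ : ℝ → X) (t : ℝ) : X :=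
  (1 / Real.Gamma β) • ∫ τ in a..t, (t - τ) ^ (β - 1) • φ τ

/-- `x ∈ AC^α([a, b], X)`: on `[a, b]`, `x = x(a) + I^α_{a+} φ` for some `φ ∈ L^∞([a, b], X)`. -/
def IsFracAC {X : Type*} [NormedAddCommGroup X] [NormedSpace ℝ X]
    (α a b : ℝ) (x : ℝ → X) : Prop :=
  ∃ φ : ℝ → X, IsLinf a b φ ∧ ∀ t ∈ Icc a b, x t = x a + rlIntegral α a φ t

/-- The Caputo derivative `(^C D^α_{a+} x)(t) = d/dt (I^{1-α}_{a+} (x(·) - x(a)))(t)`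
exists at `t` and equals `v`. -/
def HasCaputoDerivAt {X : Type*} [NormedAddCommGroup X] [NormedSpace ℝ X]
    (α a : ℝ) (x : ℝ → X) (v : X) (t : ℝ) : Prop :=
  HasDerivAt (rlIntegral (1 - α) a (fun τ => x τ - x a)) v t

/-- `x` (through its values on `[t₀, ϑ]`) is a solution of the Cauchy problem
`^C D^α_{t₀+} x = A x + b` a.e. on `[tₛ, ϑ]`, `x = w` on `[t₀, tₛ]`. -/
structure IsSolution {n : ℕ} (α t₀ tₛ ϑ : ℝ) (A : ℝ → Matrix (Fin n) (Fin n) ℝ)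
    (b w x : ℝ → Fin n → ℝ) : Prop where
  fracAC : IsFracAC α t₀ ϑ x
  initial : ∀ t ∈ Icc t₀ tₛ, x t = w t
  equation : ∀ᵐ t ∂(volume.restrict (Icc tₛ ϑ)),
    HasCaputoDerivAt α t₀ x (A t *ᵥ x t + b t) t

/-- `F` is a fundamental solution matrix: for every `s ∈ [t₀, ϑ]`, the function `F(·, s)` is a
continuous solution on `[s, ϑ]` of
`F(t, s) = Id / Γ(α)
  + ((t - s)^(1 - α) / Γ(α)) ∫_s^t A(τ) F(τ, s) (t - τ)^(α - 1) (τ - s)^(α - 1) dτ`. -/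
def IsFundamentalMatrix {n : ℕ} (α t₀ ϑ : ℝ) (A : ℝ → Matrix (Fin n) (Fin n) ℝ)
    (F : ℝ → ℝ → Matrix (Fin n) (Fin n) ℝ) : Prop :=
  ∀ s ∈ Icc t₀ ϑ, IsCont s ϑ (fun t => F t s) ∧
    ∀ t ∈ Icc s ϑ, F t s =
      (1 / Real.Gamma α) • (1 : Matrix (Fin n) (Fin n) ℝ)
      + ((t - s) ^ (1 - α) / Real.Gamma α) •
          ∫ τ in s..t, ((t - τ) ^ (α - 1) * (τ - s) ^ (α - 1)) • (A τ * F τ s)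

/-- The modified forcing term `b_*`, used for `t > tₛ`. -/
def bStar {n : ℕ} (α t₀ tₛ : ℝ) (w b : ℝ → Fin n → ℝ) (t : ℝ) : Fin n → ℝ :=
  (α / Real.Gamma (1 - α)) • (∫ τ in t₀..tₛ, (1 / (t - τ) ^ (1 + α)) • (w τ - w t₀))
  - (1 / (Real.Gamma (1 - α) * (t - tₛ) ^ α)) • (w tₛ - w t₀)
  + b t

end

end CaputoLinear

/-! Write κ_γ(u) = u₊^(γ-1)/Γ(γ). Every Riemann–Liouville integral is convolution with some κ_γ, and
the estimates rest on κ_γ * κ_δ = κ_(γ+δ) (`integrable_fracKernel_conv`), a form of the beta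
integral.

The Neumann series of y ↦ I^α(A y) has k-th kernel bounded by a multiple of M^k κ_((k+1)α)(t - s).
By convergence of the Mittag-Leffler series it sums to a resolvent kernel R with R = κ_α Id + I^α(A
R) (`resolventKernel_eq`). The fundamental matrix is F = (t - s)^(1-α) R. The same iteration applied
to an inequality is a Gronwall lemma (`eq_zero_of_le_fracKernel_integral`), the source of uniqueness
for F and for the Volterra equation. By Fubini, z(t) = ∫ R(t, τ) f(τ) dτ solves z = I^α(A z + f)
(`resolventSol_eq`).

In the Cauchy problem the derivative remembers the history w = w(t₀) + I^α φ. For t ≥ tₛ the history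
contributes I^α φ(t) - I^α φ(tₛ), and this is itself an integral of order α, started at tₛ, of a
bounded forcing (`fracInt_memoryForcing`). A second Fubini computation shows that this forcing is
b_* - b (`memoryForcing_eq`). Hence z = x - w(tₛ) solves z = I^α(A z + A w(tₛ) + b_*) on [tₛ, ϑ],
and inserting (t - τ)^(α-1) F(t, τ) = R(t, τ) into the resolvent formula gives the representation.
-/

namespace CaputoLinear

/-! ### Power kernels, their convolution, and the Mittag-Leffler series -/

section Kernel

/-- The kernel `u₊^(γ - 1) / Γ(γ)` of the Riemann–Liouville integral of order `γ`. -/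
noncomputable def fracKernel (γ u : ℝ) : ℝ :=
  if 0 < u then u ^ (γ - 1) / Real.Gamma γ else 0

lemma fracKernel_of_pos (γ : ℝ) {u : ℝ} (hu : 0 < u) :
    fracKernel γ u = u ^ (γ - 1) / Real.Gamma γ := if_pos hu

lemma fracKernel_of_nonpos (γ : ℝ) {u : ℝ} (hu : u ≤ 0) : fracKernel γ u = 0 :=
  if_neg hu.not_gt

lemma fracKernel_nonneg {γ : ℝ} (hγ : 0 < γ) (u : ℝ) : 0 ≤ fracKernel γ u := by
  have := Real.Gamma_pos_of_pos hγ
  unfold fracKernel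
  split_ifs with h
  · positivity
  · exact le_rfl

lemma fracKernel_one (u : ℝ) : fracKernel 1 u = if 0 < u then 1 else 0 := by
  simp [fracKernel]

@[fun_prop]
lemma measurable_fracKernel (γ : ℝ) : Measurable (fracKernel γ) :=
  Measurable.ite measurableSet_Ioi (by fun_prop) measurable_const

/-- After rescaling [s, t] to [0, 1] the product is a multiple of a beta density, so the convolution
integral reduces to a density having total mass one. -/
lemma fracKernel_mul_fracKernel {γ δ : ℝ} (hγ : 0 < γ) (hδ : 0 < δ) {s t : ℝ} (hst : s < t)
    (τ : ℝ) : fracKernel γ (t - τ) * fracKernel δ (τ - s) =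
      fracKernel (γ + δ) (t - s) * (t - s)⁻¹ *
        ProbabilityTheory.betaPDFReal δ γ ((τ - s) / (t - s)) := by
  have hts : 0 < t - s := sub_pos.2 hst
  have h1 := Real.Gamma_pos_of_pos hγ
  have h2 := Real.Gamma_pos_of_pos hδ
  have h3 := Real.Gamma_pos_of_pos (add_pos hγ hδ)
  unfold ProbabilityTheory.betaPDFReal ProbabilityTheory.beta
  by_cases h : s < τ ∧ τ < t
  · have ha : 0 < τ - s := sub_pos.2 h.1
    have hb : 0 < t - τ := sub_pos.2 h.2
    have hc : 0 < (τ - s) / (t - s) ∧ (τ - s) / (t - s) < 1 :=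
      ⟨by positivity, by rw [div_lt_one hts]; linarith⟩
    rw [if_pos hc, fracKernel_of_pos _ ha, fracKernel_of_pos _ hb, fracKernel_of_pos _ hts]
    have e : 1 - (τ - s) / (t - s) = (t - τ) / (t - s) := by field_simp; ring
    rw [e, Real.div_rpow ha.le hts.le, Real.div_rpow hb.le hts.le, add_comm δ γ]
    have e2 : (t - s) ^ (γ + δ - 1) = (t - s) ^ (γ - 1) * (t - s) ^ (δ - 1) * (t - s) := by
      rw [← Real.rpow_add hts, ← Real.rpow_add_one hts.ne']; ring_nf
    rw [e2]
    have := (Real.rpow_pos_of_pos hts (γ - 1)).ne'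
    have := (Real.rpow_pos_of_pos hts (δ - 1)).ne'
    field_simp
  · have hc : ¬ (0 < (τ - s) / (t - s) ∧ (τ - s) / (t - s) < 1) := by
      rintro ⟨ha, hb⟩
      rw [div_lt_one hts] at hb
      exact h ⟨by have := (div_pos_iff_of_pos_right hts).1 ha; linarith, by linarith⟩
    rw [if_neg hc]
    by_cases h' : s < τ
    · rw [fracKernel_of_nonpos γ (by by_contra h2; exact h ⟨h', by linarith⟩)]; simp
    · rw [fracKernel_of_nonpos δ (by linarith)]; simp

lemma integrable_betaPDFReal {γ δ : ℝ} (hγ : 0 < γ) (hδ : 0 < δ) :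
    Integrable (ProbabilityTheory.betaPDFReal γ δ) ∧
      ∫ x, ProbabilityTheory.betaPDFReal γ δ x = 1 := by
  have hnn : 0 ≤ ProbabilityTheory.betaPDFReal γ δ := fun x => by
    by_cases hx : 0 < x ∧ x < 1
    · exact (ProbabilityTheory.betaPDFReal_pos hx.1 hx.2 hγ hδ).le
    · simp [ProbabilityTheory.betaPDFReal, hx]
  have h1 := ProbabilityTheory.lintegral_betaPDF_eq_one hγ hδ
  have hm := (ProbabilityTheory.measurable_betaPDFReal γ δ).aestronglyMeasurable (μ := volume)
  refine ⟨⟨hm, ?_⟩, ?_⟩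
  · rw [hasFiniteIntegral_iff_ofReal (Filter.Eventually.of_forall hnn)]
    exact h1.trans_lt ENNReal.one_lt_top
  · rw [integral_eq_lintegral_of_nonneg_ae (Filter.Eventually.of_forall hnn) hm]
    exact (congrArg ENNReal.toReal h1).trans ENNReal.toReal_one

lemma integrable_fracKernel_conv {γ δ : ℝ} (hγ : 0 < γ) (hδ : 0 < δ) (s t : ℝ) :
    Integrable (fun τ => fracKernel γ (t - τ) * fracKernel δ (τ - s)) ∧
      ∫ τ, fracKernel γ (t - τ) * fracKernel δ (τ - s) = fracKernel (γ + δ) (t - s) := by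
  rcases le_or_gt t s with hst | hst
  · have : (fun τ => fracKernel γ (t - τ) * fracKernel δ (τ - s)) = fun _ => 0 := by
      ext τ
      rcases le_or_gt t τ with h | h
      · rw [fracKernel_of_nonpos γ (by linarith), zero_mul]
      · rw [fracKernel_of_nonpos δ (by linarith), mul_zero]
    rw [this, fracKernel_of_nonpos _ (by linarith)]
    simp
  · have hts : 0 < t - s := sub_pos.2 hst
    obtain ⟨hi, h1⟩ := integrable_betaPDFReal hδ hγ
    simp_rw [fracKernel_mul_fracKernel hγ hδ hst]
    refine ⟨((hi.comp_div hts.ne').comp_sub_right s).const_mul _, ?_⟩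
    rw [integral_const_mul,
      integral_sub_right_eq_self (fun x => ProbabilityTheory.betaPDFReal δ γ (x / (t - s))) s,
      Measure.integral_comp_div (fun x => ProbabilityTheory.betaPDFReal δ γ x), h1, abs_of_pos hts]
    simp [hts.ne']

/-- On a bounded range a higher order is less singular: the quotient of the kernels is a multiple of
u^(γ-δ), which is increasing. -/
lemma fracKernel_le {γ δ T u : ℝ} (hδ : 0 < δ) (hδγ : δ ≤ γ) (hu : u ≤ T) :
    fracKernel γ u ≤ T ^ (γ - δ) * Real.Gamma δ / Real.Gamma γ * fracKernel δ u := by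
  rcases le_or_gt u 0 with h | h
  · rw [fracKernel_of_nonpos _ h, fracKernel_of_nonpos _ h, mul_zero]
  · have h1 := Real.Gamma_pos_of_pos hδ
    have h2 := Real.Gamma_pos_of_pos (hδ.trans_le hδγ)
    rw [fracKernel_of_pos _ h, fracKernel_of_pos _ h]
    have e : u ^ (γ - 1) = u ^ (γ - δ) * u ^ (δ - 1) := by
      rw [← Real.rpow_add h]; ring_nf
    have h3 : u ^ (γ - δ) ≤ T ^ (γ - δ) := Real.rpow_le_rpow h.le hu (by linarith)
    rw [e]
    calc u ^ (γ - δ) * u ^ (δ - 1) / Real.Gamma γ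
        ≤ T ^ (γ - δ) * u ^ (δ - 1) / Real.Gamma γ := by gcongr
      _ = _ := by field_simp

/-- Log-convexity of Γ at x = α(x+α-1) + (1-α)(x+α), combined with Γ(x+α) = (x+α-1)Γ(x+α-1). The
decay in x drives the ratio test for the Mittag-Leffler series. -/
lemma Gamma_div_Gamma_add_le {α x : ℝ} (hα₀ : 0 < α) (hα₁ : α < 1) (hx : 1 < x) :
    Real.Gamma x / Real.Gamma (x + α) ≤ (x + α - 1) ^ (-α) := by
  have hy : 0 < x + α - 1 := by linarith
  have h := Real.Gamma_mul_add_mul_le_rpow_Gamma_mul_rpow_Gamma hy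
    (show 0 < x + α by linarith) hα₀ (show 0 < 1 - α by linarith) (by ring)
  have e : α * (x + α - 1) + (1 - α) * (x + α) = x := by ring
  have hG := Real.Gamma_pos_of_pos hy
  have e2 : Real.Gamma (x + α) = (x + α - 1) * Real.Gamma (x + α - 1) := by
    rw [← Real.Gamma_add_one hy.ne']; ring_nf
  have hG2 : 0 < Real.Gamma (x + α) := Real.Gamma_pos_of_pos (by linarith)
  rw [e] at h
  rw [div_le_iff₀ hG2]
  refine h.trans (le_of_eq ?_)
  have e3 : Real.Gamma (x + α - 1) = Real.Gamma (x + α) / (x + α - 1) := by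
    rw [e2]; field_simp
  rw [e3, Real.div_rpow hG2.le hy.le, Real.rpow_neg hy.le, Real.rpow_sub hG2, Real.rpow_one]
  field_simp

/-- The Mittag-Leffler series converges. -/
lemma summable_pow_div_Gamma {α : ℝ} (hα₀ : 0 < α) (hα₁ : α < 1) (c : ℝ) :
    Summable fun k : ℕ => c ^ k / Real.Gamma ((k + 1) * α) := by
  rcases eq_or_ne c 0 with rfl | hc
  · exact summable_of_ne_finset_zero (s := {0}) fun k hk => by
      rw [Finset.mem_singleton] at hk; simp [hk]
  have hG : ∀ k : ℕ, 0 < Real.Gamma ((k + 1) * α) := fun k =>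
    Real.Gamma_pos_of_pos (by positivity)
  refine summable_of_ratio_test_tendsto_lt_one (l := 0) zero_lt_one
    (Filter.Eventually.of_forall fun k => div_ne_zero (pow_ne_zero _ hc) (hG k).ne') ?_
  have hlim : Filter.Tendsto (fun k : ℕ => |c| * (((k : ℝ) + 1) * α + α - 1) ^ (-α)) Filter.atTop
      (nhds (|c| * 0)) := by
    refine ((tendsto_rpow_neg_atTop hα₀).comp ?_).const_mul _
    have : Filter.Tendsto (fun k : ℕ => (k : ℝ) * α + (2 * α - 1)) Filter.atTop Filter.atTop :=
      Filter.tendsto_atTop_add_const_right _ _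
        (tendsto_natCast_atTop_atTop.atTop_mul_const hα₀)
    exact this.congr fun k => by ring
  rw [mul_zero] at hlim
  have hev : ∀ᶠ k : ℕ in Filter.atTop, 1 < ((k : ℝ) + 1) * α := by
    have : Filter.Tendsto (fun k : ℕ => ((k : ℝ) + 1) * α) Filter.atTop Filter.atTop :=
      (Filter.tendsto_atTop_add_const_right _ _ tendsto_natCast_atTop_atTop).atTop_mul_const hα₀
    exact this.eventually_gt_atTop 1
  refine squeeze_zero' (Filter.Eventually.of_forall fun k => by positivity) ?_ hlim
  filter_upwards [hev] with k hk
  have h := Gamma_div_Gamma_add_le hα₀ hα₁ hk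
  have e : (((k + 1 : ℕ) : ℝ) + 1) * α = (k + 1) * α + α := by push_cast; ring
  have h2 := hG (k + 1)
  rw [e] at h2 ⊢
  rw [norm_div, norm_div, norm_pow, norm_pow, Real.norm_of_nonneg (hG k).le,
    Real.norm_of_nonneg h2.le, Real.norm_eq_abs]
  have hc' : 0 < |c| := abs_pos.2 hc
  calc |c| ^ (k + 1) / Real.Gamma ((k + 1) * α + α) / (|c| ^ k / Real.Gamma ((k + 1) * α))
      = |c| * (Real.Gamma ((k + 1) * α) / Real.Gamma ((k + 1) * α + α)) := by
        have := (hG k).ne'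
        field_simp
        ring
    _ ≤ _ := by gcongr

/-- The partial resolvent kernels are summable, locally dominated by the kernel of order `α`. -/
lemma exists_tsum_fracKernel_le {α : ℝ} (hα₀ : 0 < α) (hα₁ : α < 1) {M : ℝ} (hM : 0 ≤ M) (T : ℝ) :
    ∃ C, 0 ≤ C ∧ ∀ u ≤ T, Summable (fun k : ℕ => M ^ k * fracKernel ((k + 1) * α) u) ∧
      ∑' k : ℕ, M ^ k * fracKernel ((k + 1) * α) u ≤ C * fracKernel α u := by
  have hGα := Real.Gamma_pos_of_pos hα₀
  -- The law (T^α)^k = T^(kα) needs T ≥ 0; for negative T the constant found for 0 serves.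
  wlog hT : 0 ≤ T generalizing T
  · obtain ⟨C, h0, hC⟩ := this 0 le_rfl
    exact ⟨C, h0, fun u hu => hC u (by linarith)⟩
  have hG : ∀ k : ℕ, 0 < Real.Gamma ((k + 1) * α) := fun k =>
    Real.Gamma_pos_of_pos (by positivity)
  have hs := (summable_pow_div_Gamma hα₀ hα₁ (M * T ^ α)).mul_left (Real.Gamma α)
  -- Trading order (k+1)α for order α costs T^(kα), so the constant C is Γ(α) times the
  -- Mittag-Leffler series at M T^α.
  have hle : ∀ u ≤ T, ∀ k : ℕ, M ^ k * fracKernel ((k + 1) * α) u ≤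
      Real.Gamma α * ((M * T ^ α) ^ k / Real.Gamma ((k + 1) * α)) * fracKernel α u := by
    intro u hu k
    have h := fracKernel_le (γ := (k + 1) * α) hα₀ (by nlinarith [mul_nonneg k.cast_nonneg hα₀.le])
      hu
    calc M ^ k * fracKernel ((k + 1) * α) u ≤ M ^ k * _ :=
        mul_le_mul_of_nonneg_left h (pow_nonneg hM k)
      _ = Real.Gamma α * ((M * T ^ α) ^ k / Real.Gamma ((k + 1) * α)) * fracKernel α u := by
        have e : T ^ (((k : ℝ) + 1) * α - α) = (T ^ α) ^ k := by
          rw [← Real.rpow_natCast, ← Real.rpow_mul hT]; ring_nf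
        rw [mul_pow, ← e]; ring
  refine ⟨∑' k : ℕ, Real.Gamma α * ((M * T ^ α) ^ k / Real.Gamma ((k + 1) * α)),
    tsum_nonneg fun k => ?_, fun u hu => ?_⟩
  · have := hG k
    positivity
  · have h1 := hs.mul_right (fracKernel α u)
    have h2 : Summable (fun k : ℕ => M ^ k * fracKernel ((k + 1) * α) u) :=
      h1.of_nonneg_of_le
        (fun k => mul_nonneg (by positivity) (fracKernel_nonneg (by positivity) u)) (hle u hu)
    refine ⟨h2, ?_⟩
    rw [← tsum_mul_right]
    exact h2.tsum_le_tsum (hle u hu) h1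

end Kernel

/-! ### Fractional integrals on the line, semigroup law, singular Gronwall inequality -/

section Volterra

variable {X : Type*} [NormedAddCommGroup X]

/-- By Tonelli: integrating the dominating chain in τ leaves κ_(γ+δ)(t - σ) κ_ε(σ - s), which is
again integrable. This licenses Fubini in the semigroup law, in the variation of constants and in
the history integral. -/
lemma integrable_prod_of_norm_le_fracKernel {K : ℝ → ℝ → X}
    (hK : StronglyMeasurable (Function.uncurry K)) {γ δ ε s t C : ℝ} (hγ : 0 < γ) (hδ : 0 < δ)
    (hε : 0 < ε)
    (h : ∀ τ σ, ‖K τ σ‖ ≤ C * (fracKernel γ (t - τ) * fracKernel δ (τ - σ) * fracKernel ε (σ - s))) :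
    Integrable (Function.uncurry K) (volume.prod volume) := by
  have hd : Integrable (fun p : ℝ × ℝ =>
      C * (fracKernel γ (t - p.1) * fracKernel δ (p.1 - p.2) * fracKernel ε (p.2 - s)))
      (volume.prod volume) := by
    refine Integrable.const_mul ?_ C
    have hm : Measurable (fun p : ℝ × ℝ =>
      fracKernel γ (t - p.1) * fracKernel δ (p.1 - p.2) * fracKernel ε (p.2 - s)) := by fun_prop
    rw [integrable_prod_iff' hm.aestronglyMeasurable]
    refine ⟨Filter.Eventually.of_forall fun σ =>
      (integrable_fracKernel_conv hγ hδ σ t).1.mul_const (fracKernel ε (σ - s)), ?_⟩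
    refine (integrable_fracKernel_conv (add_pos hγ hδ) hε s t).1.congr
      (Filter.Eventually.of_forall fun σ => ?_)
    dsimp only
    rw [← (integrable_fracKernel_conv hγ hδ σ t).2, ← integral_mul_const]
    refine integral_congr_ae (Filter.Eventually.of_forall fun τ => ?_)
    exact (Real.norm_of_nonneg (mul_nonneg (mul_nonneg (fracKernel_nonneg hγ _)
      (fracKernel_nonneg hδ _)) (fracKernel_nonneg hε _))).symm
  exact hd.mono' hK.aestronglyMeasurable (Filter.Eventually.of_forall fun p => h p.1 p.2)

variable [NormedSpace ℝ X]

/-- The Riemann–Liouville integral of order `γ` over the whole half-line to the left of `t`. -/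
noncomputable def fracInt (γ : ℝ) (φ : ℝ → X) (t : ℝ) : X := ∫ τ, fracKernel γ (t - τ) • φ τ

lemma stronglyMeasurable_fracInt (γ : ℝ) {φ : ℝ → X} (hφ : StronglyMeasurable φ) :
    StronglyMeasurable (fracInt γ φ) := by
  refine StronglyMeasurable.integral_prod_right (f := fun t τ => fracKernel γ (t - τ) • φ τ) ?_
  exact (Measurable.stronglyMeasurable (by fun_prop)).smul (hφ.comp_measurable measurable_snd)

section Bound

variable {γ ε C s : ℝ} {φ : ℝ → X} (hγ : 0 < γ) (hε : 0 < ε)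
  (hC : ∀ τ, ‖φ τ‖ ≤ C * fracKernel ε (τ - s))

lemma norm_fracKernel_smul_le (hγ : 0 < γ) {v : X} {c : ℝ} (hv : ‖v‖ ≤ c) (u : ℝ) :
    ‖fracKernel γ u • v‖ ≤ fracKernel γ u * c := by
  rw [norm_smul, Real.norm_of_nonneg (fracKernel_nonneg hγ _)]
  exact mul_le_mul_of_nonneg_left hv (fracKernel_nonneg hγ _)

include hγ hε hC

/-- The bound by C κ_ε(τ - s) does two jobs: it controls the singularity at s and forces φ to vanish
to the left of s, so the whole-line integral really starts at s. -/
lemma integrable_fracKernel_smul (hφ : StronglyMeasurable φ) (t : ℝ) :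
    Integrable fun τ => fracKernel γ (t - τ) • φ τ := by
  refine ((integrable_fracKernel_conv hγ hε s t).1.const_mul C).mono'
    ((Measurable.stronglyMeasurable (by fun_prop)).smul hφ).aestronglyMeasurable
    (Filter.Eventually.of_forall fun τ => ?_)
  exact (norm_fracKernel_smul_le hγ (hC τ) _).trans (le_of_eq (by ring))

lemma norm_fracInt_le (t : ℝ) : ‖fracInt γ φ t‖ ≤ C * fracKernel (γ + ε) (t - s) := by
  obtain ⟨hi, h⟩ := integrable_fracKernel_conv hγ hε s t
  rw [← h, ← integral_const_mul]
  refine norm_integral_le_of_norm_le (hi.const_mul C) (Filter.Eventually.of_forall fun τ => ?_)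
  exact (norm_fracKernel_smul_le hγ (hC τ) _).trans (le_of_eq (by ring))

/-- The semigroup property of the Riemann–Liouville integrals. -/
lemma fracInt_fracInt [CompleteSpace X] (hφ : StronglyMeasurable φ) {δ : ℝ} (hδ : 0 < δ) (t : ℝ) :
    fracInt γ (fracInt δ φ) t = fracInt (γ + δ) φ t := by
  have hint : Integrable (Function.uncurry fun τ σ =>
      fracKernel γ (t - τ) • fracKernel δ (τ - σ) • φ σ) (volume.prod volume) := by
    refine integrable_prod_of_norm_le_fracKernel (γ := γ) (δ := δ) (ε := ε) (C := C) (s := s)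
      (t := t) ?_ hγ hδ hε fun τ σ => ?_
    · exact (Measurable.stronglyMeasurable (by fun_prop)).smul
        ((Measurable.stronglyMeasurable (by fun_prop)).smul (hφ.comp_measurable measurable_snd))
    · refine (norm_fracKernel_smul_le hγ (norm_fracKernel_smul_le hδ (hC σ) _) _).trans
        (le_of_eq (by ring))
  calc fracInt γ (fracInt δ φ) t
      = ∫ τ, ∫ σ, fracKernel γ (t - τ) • fracKernel δ (τ - σ) • φ σ := by
        simp_rw [fracInt, integral_smul]
    _ = ∫ σ, ∫ τ, fracKernel γ (t - τ) • fracKernel δ (τ - σ) • φ σ :=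
        integral_integral_swap hint
    _ = fracInt (γ + δ) φ t := by
        refine integral_congr_ae (Filter.Eventually.of_forall fun σ => ?_)
        simp_rw [smul_smul]
        rw [integral_smul_const, (integrable_fracKernel_conv hγ hδ σ t).2]

end Bound

/-- A Gronwall inequality for the weakly singular kernel. -/
lemma eq_zero_of_le_fracKernel_integral {α : ℝ} (hα₀ : 0 < α) (hα₁ : α < 1) {B M s ϑ : ℝ}
    (hM : 0 ≤ M) {u : ℝ → ℝ} (h0 : ∀ t, 0 ≤ u t) (hB : ∀ t ≤ ϑ, u t ≤ B * fracKernel α (t - s))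
    (hV : ∀ t ≤ ϑ, u t ≤ M * ∫ τ, fracKernel α (t - τ) * u τ) {t : ℝ} (ht : t ≤ ϑ) : u t = 0 := by
  -- Feeding the inequality into itself k times bounds u by the general term of a convergent series,
  -- which tends to zero.
  have key : ∀ k : ℕ, ∀ t ≤ ϑ, u t ≤ B * (M ^ k * fracKernel ((k + 1) * α) (t - s)) := by
    intro k
    induction k with
    | zero => simpa using hB
    | succ k ih =>
      intro t ht
      have hk : 0 < ((k : ℝ) + 1) * α := by positivity
      obtain ⟨hi, he⟩ := integrable_fracKernel_conv hα₀ hk s t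
      have e : (((k + 1 : ℕ) : ℝ) + 1) * α = α + (k + 1) * α := by push_cast; ring
      calc u t ≤ M * ∫ τ, fracKernel α (t - τ) * u τ := hV t ht
        _ ≤ M * ∫ τ, (B * M ^ k) *
            (fracKernel α (t - τ) * fracKernel ((k + 1) * α) (τ - s)) := by
          refine mul_le_mul_of_nonneg_left (integral_mono_of_nonneg
            (Filter.Eventually.of_forall fun τ => mul_nonneg (fracKernel_nonneg hα₀ _) (h0 τ))
            (hi.const_mul _) (Filter.Eventually.of_forall fun τ => ?_)) hM
          rcases le_or_gt t τ with h | h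
          · simp [fracKernel_of_nonpos α (sub_nonpos.2 h)]
          · refine (mul_le_mul_of_nonneg_left (ih τ (by linarith))
              (fracKernel_nonneg hα₀ _)).trans (le_of_eq (by ring))
        _ = _ := by rw [integral_const_mul, he, e]; ring
  obtain ⟨_, _, hs⟩ := exists_tsum_fracKernel_le hα₀ hα₁ hM (t - s)
  have hlim := ((hs _ le_rfl).1.tendsto_atTop_zero).const_mul B
  rw [mul_zero] at hlim
  exact le_antisymm (ge_of_tendsto' hlim fun k => key k t ht) (h0 t)

end Volterra

/-! ### The resolvent kernel as a Neumann series -/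

section Resolvent

variable {R : Type*} [NormedRing R] [NormedAlgebra ℝ R]

/-- The iterated kernels whose sum is the resolvent of the Volterra operator `y ↦ I^α (A y)`. -/
noncomputable def resolventTerm (α : ℝ) (A : ℝ → R) : ℕ → ℝ → ℝ → R
  | 0 => fun t s => fracKernel α (t - s) • 1
  | k + 1 => fun t s => fracInt α (fun τ => A τ * resolventTerm α A k τ s) t

/-- The resolvent kernel of the Volterra operator `y ↦ I^α (A y)`; it equals
`(t - s)^(α - 1) F(t, s)` for the fundamental matrix `F`. -/
noncomputable def resolventKernel (α : ℝ) (A : ℝ → R) (t s : ℝ) : R :=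
  ∑' k, resolventTerm α A k t s

variable {α M : ℝ} {A : ℝ → R}

lemma stronglyMeasurable_resolventTerm (hA : StronglyMeasurable A) (k : ℕ) :
    StronglyMeasurable (Function.uncurry (resolventTerm α A k)) := by
  induction k with
  | zero => exact (Measurable.stronglyMeasurable (by fun_prop)).smul stronglyMeasurable_const
  | succ k ih =>
    refine StronglyMeasurable.integral_prod_right (f := fun (p : ℝ × ℝ) τ =>
      fracKernel α (p.1 - τ) • (A τ * resolventTerm α A k τ p.2)) ?_
    refine (Measurable.stronglyMeasurable (by fun_prop)).smul
      ((hA.comp_measurable measurable_snd).mul ?_)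
    exact ih.comp_measurable (measurable_snd.prodMk (measurable_snd.comp measurable_fst))

omit [NormedAlgebra ℝ R] in
lemma norm_mul_le_of_bound (hAM : ∀ t, ‖A t‖ ≤ M) {v : R} {c : ℝ} (hv : ‖v‖ ≤ c) (t : ℝ) :
    ‖A t * v‖ ≤ M * c :=
  (norm_mul_le _ _).trans (mul_le_mul (hAM t) hv (norm_nonneg _) ((norm_nonneg _).trans (hAM t)))

/-- Each iteration multiplies by M and convolves with κ_α, raising the order by α. The factor ‖1‖
stays because it need not be 1; for matrices of size zero it is 0. -/
lemma norm_resolventTerm_le (hα₀ : 0 < α) (hAM : ∀ t, ‖A t‖ ≤ M) (k : ℕ) (t s : ℝ) :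
    ‖resolventTerm α A k t s‖ ≤ ‖(1 : R)‖ * (M ^ k * fracKernel ((k + 1) * α) (t - s)) := by
  induction k generalizing t with
  | zero =>
    rw [resolventTerm, norm_smul, Real.norm_of_nonneg (fracKernel_nonneg hα₀ _)]
    simp [mul_comm]
  | succ k ih =>
    have hk : 0 < ((k : ℝ) + 1) * α := by positivity
    have e : (((k + 1 : ℕ) : ℝ) + 1) * α = α + (k + 1) * α := by push_cast; ring
    rw [resolventTerm, e]
    refine (norm_fracInt_le (C := ‖(1 : R)‖ * M ^ (k + 1)) hα₀ hk (fun τ => ?_) t).trans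
      (le_of_eq (by ring))
    exact (norm_mul_le_of_bound hAM (ih τ) τ).trans (le_of_eq (by ring))

/-- The first term carries the whole singularity, so the sum is no worse than κ_α. The constant
grows with T, hence the restriction on t - s. -/
lemma exists_norm_resolventKernel_le (hα₀ : 0 < α) (hα₁ : α < 1) (hAM : ∀ t, ‖A t‖ ≤ M) (T : ℝ) :
    ∃ C, 0 ≤ C ∧ ∀ t s, t - s ≤ T → ‖resolventKernel α A t s‖ ≤ C * fracKernel α (t - s) := by
  have hM : 0 ≤ M := (norm_nonneg _).trans (hAM 0)
  obtain ⟨C, hC, h⟩ := exists_tsum_fracKernel_le hα₀ hα₁ hM T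
  refine ⟨‖(1 : R)‖ * C, by positivity, fun t s hts => ?_⟩
  obtain ⟨h1, h2⟩ := h _ hts
  refine (tsum_of_norm_bounded (h1.hasSum.mul_left ‖(1 : R)‖)
    fun k => norm_resolventTerm_le hα₀ hAM k t s).trans ?_
  rw [mul_assoc]
  gcongr

variable [CompleteSpace R]

lemma summable_resolventTerm (hα₀ : 0 < α) (hα₁ : α < 1) (hAM : ∀ t, ‖A t‖ ≤ M) (t s : ℝ) :
    Summable fun k => resolventTerm α A k t s := by
  have hM : 0 ≤ M := (norm_nonneg _).trans (hAM 0)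
  obtain ⟨C, hC, h⟩ := exists_tsum_fracKernel_le hα₀ hα₁ hM (t - s)
  exact ((h _ le_rfl).1.mul_left ‖(1 : R)‖).of_norm_bounded
    fun k => norm_resolventTerm_le hα₀ hAM k t s

lemma stronglyMeasurable_resolventKernel (hα₀ : 0 < α) (hα₁ : α < 1) (hA : StronglyMeasurable A)
    (hAM : ∀ t, ‖A t‖ ≤ M) : StronglyMeasurable (Function.uncurry (resolventKernel α A)) := by
  refine stronglyMeasurable_of_tendsto (f := fun n p => ∑ k ∈ Finset.range n,
    Function.uncurry (resolventTerm α A k) p) Filter.atTop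
    (fun n => Finset.stronglyMeasurable_fun_sum _
      fun k _ => stronglyMeasurable_resolventTerm hA k) ?_
  rw [tendsto_pi_nhds]
  exact fun p => (summable_resolventTerm hα₀ hα₁ hAM p.1 p.2).hasSum.tendsto_sum_nat

/-- The resolvent equation. -/
lemma resolventKernel_eq (hα₀ : 0 < α) (hα₁ : α < 1) (hA : StronglyMeasurable A)
    (hAM : ∀ t, ‖A t‖ ≤ M) (t s : ℝ) :
    resolventKernel α A t s =
      fracKernel α (t - s) • 1 + fracInt α (fun τ => A τ * resolventKernel α A τ s) t := by
  have hM : 0 ≤ M := (norm_nonneg _).trans (hAM 0)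
  have hG : ∀ k : ℕ, StronglyMeasurable fun τ => A τ * resolventTerm α A k τ s := fun k =>
    hA.mul ((stronglyMeasurable_resolventTerm hA k).comp_measurable
      (measurable_id.prodMk measurable_const))
  have hb : ∀ (k : ℕ) τ, ‖A τ * resolventTerm α A k τ s‖ ≤
      (‖(1 : R)‖ * M ^ (k + 1)) * fracKernel ((k + 1) * α) (τ - s) := fun k τ =>
    (norm_mul_le_of_bound hAM (norm_resolventTerm_le hα₀ hAM k τ s) τ).trans (le_of_eq (by ring))
  have hk : ∀ k : ℕ, 0 < ((k : ℝ) + 1) * α := fun k => by positivity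
  have hsum := summable_resolventTerm (A := A) hα₀ hα₁ hAM
  rw [resolventKernel, (hsum t s).tsum_eq_zero_add]
  congr 1
  have hi := fun k => integrable_fracKernel_smul hα₀ (hk k) (hb k) (hG k) t
  -- Sum and integral may be exchanged: the k-th integral of norms is at most ‖1‖ times term k + 1
  -- of the dominating series.
  have hsn : Summable fun k : ℕ => ∫ τ, ‖fracKernel α (t - τ) • (A τ * resolventTerm α A k τ s)‖ := by
    obtain ⟨_, _, h⟩ := exists_tsum_fracKernel_le hα₀ hα₁ hM (t - s)
    have h1 := (((summable_nat_add_iff 1).2 (h _ le_rfl).1).mul_left ‖(1 : R)‖)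
    refine h1.of_nonneg_of_le (fun k => integral_nonneg fun _ => norm_nonneg _) fun k => ?_
    obtain ⟨hc, he⟩ := integrable_fracKernel_conv hα₀ (hk k) s t
    have e : (((k + 1 : ℕ) : ℝ) + 1) * α = α + (k + 1) * α := by push_cast; ring
    rw [e, ← he, ← mul_assoc, ← integral_const_mul]
    refine integral_mono (hi k).norm (hc.const_mul _) fun τ => ?_
    exact (norm_fracKernel_smul_le hα₀ (hb k τ) _).trans (le_of_eq (by ring))
  have h := (hasSum_integral_of_summable_integral_norm hi hsn).tsum_eq
  refine h.trans (integral_congr_ae (Filter.Eventually.of_forall fun τ => ?_))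
  dsimp only
  rw [((hsum τ s).mul_left (A τ)).tsum_const_smul, (hsum τ s).tsum_mul_left]
  rfl

lemma integrable_fracKernel_smul_resolventKernel (hα₀ : 0 < α) (hα₁ : α < 1)
    (hA : StronglyMeasurable A) (hAM : ∀ t, ‖A t‖ ≤ M) (t s : ℝ) :
    Integrable fun τ => fracKernel α (t - τ) • (A τ * resolventKernel α A τ s) := by
  obtain ⟨D, -, h⟩ := exists_norm_resolventKernel_le (A := A) hα₀ hα₁ hAM (t - s)
  refine ((integrable_fracKernel_conv hα₀ hα₀ s t).1.const_mul (M * D)).mono'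
    ((Measurable.stronglyMeasurable (by fun_prop)).smul (hA.mul
      ((stronglyMeasurable_resolventKernel hα₀ hα₁ hA hAM).comp_measurable
        (measurable_id.prodMk measurable_const)))).aestronglyMeasurable
    (Filter.Eventually.of_forall fun τ => ?_)
  rcases le_or_gt t τ with hτ | hτ
  · simp [fracKernel_of_nonpos α (sub_nonpos.2 hτ)]
  · exact (norm_fracKernel_smul_le hα₀ (norm_mul_le_of_bound hAM (h τ s (by linarith)) τ)
      _).trans (le_of_eq (by ring))

/-! ### Variation of constants for the Volterra equation -/

section VariationOfConstants

variable {E : Type*} [NormedAddCommGroup E] [NormedSpace ℝ E] [CompleteSpace E]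
  (L : R →L[ℝ] E →L[ℝ] E) {C s : ℝ} {f : ℝ → E}

/-- The solution of `y = I^α (A y + f)` given by the resolvent kernel, where `A` acts on `E`
through `L`. -/
noncomputable def resolventSol (α : ℝ) (A : ℝ → R) (f : ℝ → E) (t : ℝ) : E :=
  ∫ τ, L (resolventKernel α A t τ) (f τ)

omit [CompleteSpace E] in
lemma stronglyMeasurable_resolventKernel_apply (hα₀ : 0 < α) (hα₁ : α < 1)
    (hA : StronglyMeasurable A) (hAM : ∀ t, ‖A t‖ ≤ M) (hf : StronglyMeasurable f) :
    StronglyMeasurable (Function.uncurry fun t τ => L (resolventKernel α A t τ) (f τ)) :=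
  L.continuous₂.comp_stronglyMeasurable
    ((stronglyMeasurable_resolventKernel hα₀ hα₁ hA hAM).prodMk (hf.comp_measurable measurable_snd))

variable (hα₀ : 0 < α) (hα₁ : α < 1) (hA : StronglyMeasurable A) (hAM : ∀ t, ‖A t‖ ≤ M)
  (hf : StronglyMeasurable f) (hfC : ∀ τ, ‖f τ‖ ≤ C * fracKernel 1 (τ - s))

include hα₀ hα₁ hA hAM hf

omit [CompleteSpace E] in
lemma stronglyMeasurable_resolventSol : StronglyMeasurable (resolventSol L α A f) :=
  (stronglyMeasurable_resolventKernel_apply L hα₀ hα₁ hA hAM hf).integral_prod_right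

include hfC

omit [CompleteSpace R] [CompleteSpace E] hA hf in
lemma exists_norm_resolventKernel_apply_le (T : ℝ) : ∃ D, 0 ≤ D ∧ ∀ t τ, t ≤ T →
    ‖L (resolventKernel α A t τ) (f τ)‖ ≤ D * (fracKernel α (t - τ) * fracKernel 1 (τ - s)) := by
  -- Since f vanishes for τ ≤ s, only differences t - τ < T - s matter.
  obtain ⟨D, hD, h⟩ := exists_norm_resolventKernel_le (A := A) hα₀ hα₁ hAM (T - s)
  refine ⟨‖L‖ * D * |C|, by positivity, fun t τ ht => ?_⟩
  rcases le_or_gt τ s with hτ | hτ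
  · have := hfC τ
    rw [fracKernel_of_nonpos 1 (by linarith), mul_zero, norm_le_zero_iff] at this
    rw [this, map_zero, norm_zero, fracKernel_of_nonpos 1 (by linarith)]
    simp
  · have h2 : ‖f τ‖ ≤ |C| * fracKernel 1 (τ - s) := (hfC τ).trans
      (mul_le_mul_of_nonneg_right (le_abs_self C) (fracKernel_nonneg one_pos _))
    refine ((L _).le_opNorm _).trans ?_
    calc ‖L (resolventKernel α A t τ)‖ * ‖f τ‖
        ≤ (‖L‖ * (D * fracKernel α (t - τ))) * (|C| * fracKernel 1 (τ - s)) := by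
          refine mul_le_mul ((L.le_opNorm _).trans
            (mul_le_mul_of_nonneg_left (h t τ (by linarith)) (norm_nonneg _))) h2
            (norm_nonneg _) (mul_nonneg (by positivity)
              (mul_nonneg hD (fracKernel_nonneg hα₀ _)))
      _ = _ := by ring

omit [CompleteSpace E] in
lemma integrable_resolventKernel_apply (t : ℝ) :
    Integrable fun τ => L (resolventKernel α A t τ) (f τ) := by
  obtain ⟨D, -, h⟩ := exists_norm_resolventKernel_apply_le L hα₀ hα₁ hAM hfC t
  refine ((integrable_fracKernel_conv hα₀ one_pos s t).1.const_mul D).mono'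
    ((stronglyMeasurable_resolventKernel_apply L hα₀ hα₁ hA hAM hf).comp_measurable
      (measurable_const.prodMk measurable_id)).aestronglyMeasurable
    (Filter.Eventually.of_forall fun τ => h t τ le_rfl)

omit [CompleteSpace R] [CompleteSpace E] hA hf in
lemma exists_norm_resolventSol_le (T : ℝ) : ∃ D, 0 ≤ D ∧ ∀ t ≤ T,
    ‖resolventSol L α A f t‖ ≤ D * fracKernel (α + 1) (t - s) := by
  obtain ⟨D, hD, h⟩ := exists_norm_resolventKernel_apply_le L hα₀ hα₁ hAM hfC T
  refine ⟨D, hD, fun t ht => ?_⟩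
  obtain ⟨hi, he⟩ := integrable_fracKernel_conv hα₀ one_pos s t
  rw [← he, ← integral_const_mul]
  exact norm_integral_le_of_norm_le (hi.const_mul D)
    (Filter.Eventually.of_forall fun τ => h t τ ht)

/-- Apply the resolvent equation for R(t, σ) to f(σ) and integrate in σ: the first term gives I^α f,
and after Fubini the second gives I^α(A z). -/
lemma resolventSol_eq (hL : ∀ a b v, L (a * b) v = L a (L b v)) (hL1 : ∀ v, L 1 v = v) (t : ℝ) :
    resolventSol L α A f t = fracInt α (fun τ => L (A τ) (resolventSol L α A f τ) + f τ) t := by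
  obtain ⟨D, hD, h⟩ := exists_norm_resolventKernel_apply_le L hα₀ hα₁ hAM hfC t
  have hmG := stronglyMeasurable_resolventKernel_apply L hα₀ hα₁ hA hAM hf
  have hM : 0 ≤ M := (norm_nonneg _).trans (hAM 0)
  have hm1 : StronglyMeasurable (Function.uncurry fun τ σ : ℝ =>
      fracKernel α (t - τ) • L (A τ) (L (resolventKernel α A τ σ) (f σ))) :=
    (Measurable.stronglyMeasurable (by fun_prop)).smul
      (L.continuous₂.comp_stronglyMeasurable ((hA.comp_measurable measurable_fst).prodMk hmG))
  have hint : Integrable (Function.uncurry fun τ σ =>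
      fracKernel α (t - τ) • L (A τ) (L (resolventKernel α A τ σ) (f σ)))
      (volume.prod volume) := by
    refine integrable_prod_of_norm_le_fracKernel (γ := α) (δ := α) (ε := 1) (C := ‖L‖ * M * D)
      (s := s) (t := t) hm1 hα₀ hα₀ one_pos fun τ σ => ?_
    rcases le_or_gt t τ with hτ | hτ
    · simp [fracKernel_of_nonpos α (sub_nonpos.2 hτ)]
    · have h1 : ‖L (A τ) (L (resolventKernel α A τ σ) (f σ))‖ ≤
          ‖L‖ * M * (D * (fracKernel α (τ - σ) * fracKernel 1 (σ - s))) := by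
        refine ((L _).le_opNorm _).trans (mul_le_mul ((L.le_opNorm _).trans
          (mul_le_mul_of_nonneg_left (hAM τ) (norm_nonneg _))) (h τ σ hτ.le)
            (norm_nonneg _) (by positivity))
      exact (norm_fracKernel_smul_le hα₀ h1 _).trans (le_of_eq (by ring))
  have hGeq : ∀ σ, L (resolventKernel α A t σ) (f σ) = fracKernel α (t - σ) • f σ +
      ∫ τ, fracKernel α (t - τ) • L (A τ) (L (resolventKernel α A τ σ) (f σ)) := by
    intro σ
    have hi := integrable_fracKernel_smul_resolventKernel hα₀ hα₁ hA hAM t σ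
    rw [resolventKernel_eq hα₀ hα₁ hA hAM t σ, map_add, add_apply, map_smul,
      smul_apply, hL1]
    congr 1
    have := ((L.flip (f σ)).integral_comp_comm hi).symm
    simpa [fracInt, hL] using this
  have hinner : ∀ τ, ∫ σ, fracKernel α (t - τ) • L (A τ) (L (resolventKernel α A τ σ) (f σ)) =
      fracKernel α (t - τ) • L (A τ) (resolventSol L α A f τ) := fun τ => by
    rw [integral_smul, ContinuousLinearMap.integral_comp_comm _
      (integrable_resolventKernel_apply L hα₀ hα₁ hA hAM hf hfC τ)]
    rfl
  have hi1 := integrable_fracKernel_smul hα₀ one_pos hfC hf t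
  have hi2 := hint.integral_prod_right
  have hi3 := hint.integral_prod_left
  simp only [Function.uncurry_apply_pair, hinner] at hi2 hi3
  calc resolventSol L α A f t = ∫ σ, (fracKernel α (t - σ) • f σ +
        ∫ τ, fracKernel α (t - τ) • L (A τ) (L (resolventKernel α A τ σ) (f σ))) := by
        simp_rw [resolventSol, hGeq]
    _ = (∫ σ, fracKernel α (t - σ) • f σ) +
        ∫ σ, ∫ τ, fracKernel α (t - τ) • L (A τ) (L (resolventKernel α A τ σ) (f σ)) :=
        integral_add hi1 hi2
    _ = (∫ σ, fracKernel α (t - σ) • f σ) +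
        ∫ τ, fracKernel α (t - τ) • L (A τ) (resolventSol L α A f τ) := by
        rw [← integral_integral_swap hint]
        simp_rw [hinner]
    _ = _ := by
        rw [add_comm, ← integral_add hi3 hi1]
        simp_rw [fracInt, smul_add]

end VariationOfConstants

end Resolvent

/-! ### From interval integrals to integrals over the line -/

section IntervalIntegral

variable {X : Type*} [NormedAddCommGroup X] {h k : ℝ → X} {s t : ℝ}

lemma intervalIntegrable_of_integrable (hst : s ≤ t)
    (hhk : ∀ᵐ τ, τ ∈ Ioo s t → h τ = k τ) (hk : Integrable k) :
    IntervalIntegrable h volume s t := by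
  rw [intervalIntegrable_iff_integrableOn_Ioo_of_le hst]
  refine hk.integrableOn.congr ?_
  rw [Filter.EventuallyEq, ae_restrict_iff' measurableSet_Ioo]
  filter_upwards [hhk] with τ hτ hm using (hτ hm).symm

variable [NormedSpace ℝ X]

/-- Agreement is asked only on the open interval, so the endpoints, where negative powers of zero
appear, play no role. -/
lemma intervalIntegral_eq_integral (hst : s ≤ t)
    (hhk : ∀ᵐ τ, τ ∈ Ioo s t → h τ = k τ) (hk : ∀ τ ∉ Ioo s t, k τ = 0) :
    ∫ τ in s..t, h τ = ∫ τ, k τ := by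
  rw [intervalIntegral.integral_of_le hst, integral_Ioc_eq_integral_Ioo,
    ← setIntegral_eq_integral_of_forall_compl_eq_zero hk]
  exact setIntegral_congr_ae measurableSet_Ioo hhk

/-- On functions vanishing to the left of `s`, `fracInt` is the Riemann–Liouville integral
from `s`. -/
lemma rlIntegral_eq_fracInt {γ : ℝ} {φ ψ : ℝ → X} (hst : s ≤ t)
    (hφψ : ∀ᵐ τ, τ ∈ Ioo s t → φ τ = ψ τ) (hψ : ∀ τ ≤ s, ψ τ = 0) :
    rlIntegral γ s φ t = fracInt γ ψ t := by
  rw [rlIntegral, ← intervalIntegral.integral_smul]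
  refine intervalIntegral_eq_integral hst ?_ fun τ hτ => ?_
  · filter_upwards [hφψ] with τ hτ hm
    rw [hτ hm, fracKernel_of_pos γ (sub_pos.2 hm.2), smul_smul]
    congr 1
    ring
  · rcases le_or_gt τ s with h1 | h1
    · rw [hψ τ h1, smul_zero]
    · rw [fracKernel_of_nonpos γ (sub_nonpos.2 (not_lt.1 fun h2 => hτ ⟨h1, h2⟩)), zero_smul]

end IntervalIntegral

/-! ### Continuity of fractional integrals -/

section Continuity

lemma continuousAt_fracKernel (γ : ℝ) {u : ℝ} (hu : u ≠ 0) : ContinuousAt (fracKernel γ) u := by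
  rcases hu.lt_or_gt with h | h
  · refine (continuousAt_const (y := (0 : ℝ))).congr ?_
    filter_upwards [Iio_mem_nhds h] with v hv using (fracKernel_of_nonpos γ (le_of_lt hv)).symm
  · refine ((Real.continuousAt_rpow_const u (γ - 1) (Or.inl h.ne')).div_const
      (Real.Gamma γ)).congr ?_
    filter_upwards [Ioi_mem_nhds h] with v hv using (fracKernel_of_pos γ hv).symm

/-- Scheffé's argument, since the singularity moves with r. From |f_r - f_t| = f_r - f_t + 2 (f_t -
f_r)⁺, the total masses converge by the convolution formula and the positive part is dominated by
the fixed function f_t. -/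
lemma tendsto_integral_abs_fracKernel_sub {γ δ s t : ℝ} (hγ : 0 < γ) (hδ : 0 < δ) (hst : s < t) :
    Filter.Tendsto (fun r => ∫ τ, |fracKernel γ (r - τ) - fracKernel γ (t - τ)| *
      fracKernel δ (τ - s)) (nhds t) (nhds 0) := by
  set f : ℝ → ℝ → ℝ := fun r τ => fracKernel γ (r - τ) * fracKernel δ (τ - s)
  have hf : ∀ r, Integrable (f r) := fun r => (integrable_fracKernel_conv hγ hδ s r).1
  have hf0 : ∀ r τ, 0 ≤ f r τ := fun r τ =>
    mul_nonneg (fracKernel_nonneg hγ _) (fracKernel_nonneg hδ _)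
  have hsub : ∀ r, Integrable fun τ => max (f t τ - f r τ) 0 := fun r =>
    ((hf t).sub (hf r)).pos_part
  have heq : ∀ r, ∫ τ, |fracKernel γ (r - τ) - fracKernel γ (t - τ)| * fracKernel δ (τ - s) =
      fracKernel (γ + δ) (r - s) - fracKernel (γ + δ) (t - s) +
        2 * ∫ τ, max (f t τ - f r τ) 0 := by
    intro r
    have hfr : Integrable fun τ => f r τ - f t τ := (hf r).sub (hf t)
    rw [← (integrable_fracKernel_conv hγ hδ s r).2, ← (integrable_fracKernel_conv hγ hδ s t).2,
      ← integral_sub (hf r) (hf t), ← integral_const_mul,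
      ← integral_add hfr ((hsub r).const_mul 2)]
    refine integral_congr_ae (Filter.Eventually.of_forall fun τ => ?_)
    dsimp only
    have habs : |fracKernel γ (r - τ) - fracKernel γ (t - τ)| * fracKernel δ (τ - s) =
        |f r τ - f t τ| := by
      rw [← sub_mul, abs_mul, abs_of_nonneg (fracKernel_nonneg hδ (τ - s))]
    rw [habs]
    change |f r τ - f t τ| = f r τ - f t τ + 2 * max (f t τ - f r τ) 0
    rcases le_total (f t τ) (f r τ) with h | h
    · rw [abs_of_nonneg (by linarith), max_eq_right (by linarith)]; ring
    · rw [abs_of_nonpos (by linarith), max_eq_left (by linarith)]; ring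
  have h1 : Filter.Tendsto (fun r => ∫ τ, max (f t τ - f r τ) 0) (nhds t)
      (nhds (∫ _ : ℝ, (0 : ℝ))) := by
    refine tendsto_integral_filter_of_dominated_convergence (f t)
      (Filter.Eventually.of_forall fun r => (hsub r).aestronglyMeasurable)
      (Filter.Eventually.of_forall fun r => Filter.Eventually.of_forall fun τ => ?_) (hf t) ?_
    · rw [Real.norm_of_nonneg (le_max_right _ _)]
      exact max_le (by linarith [hf0 r τ]) (hf0 t τ)
    · filter_upwards [compl_mem_ae_iff.2 ((Set.finite_singleton t).measure_zero volume)] with τ hτ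
      have hc : ContinuousAt (fun r => max (f t τ - f r τ) 0) t := by
        have : ContinuousAt (fun r => fracKernel γ (r - τ)) t :=
          ContinuousAt.comp (f := fun r => r - τ)
            (continuousAt_fracKernel γ (sub_ne_zero.2 fun h => hτ h.symm)) (by fun_prop)
        exact (continuousAt_const.sub (this.mul continuousAt_const)).max continuousAt_const
      simpa using hc.tendsto
  have h2 : Filter.Tendsto (fun r => fracKernel (γ + δ) (r - s)) (nhds t)
      (nhds (fracKernel (γ + δ) (t - s))) :=
    (ContinuousAt.comp (f := fun r => r - s)
      (continuousAt_fracKernel (γ + δ) (sub_pos.2 hst).ne') (by fun_prop)).tendsto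
  simp_rw [heq]
  simpa using (h2.sub_const (fracKernel (γ + δ) (t - s))).add (h1.const_mul 2)

variable {X : Type*} [NormedAddCommGroup X] [NormedSpace ℝ X]

lemma continuousAt_fracInt {γ δ C s t : ℝ} (hγ : 0 < γ) (hδ : 0 < δ) {φ : ℝ → X}
    (hφ : StronglyMeasurable φ) (hC : ∀ τ, ‖φ τ‖ ≤ C * fracKernel δ (τ - s)) (hst : s < t) :
    ContinuousAt (fracInt γ φ) t := by
  have h := (tendsto_integral_abs_fracKernel_sub hγ hδ hst).const_mul C
  rw [mul_zero] at h
  refine tendsto_iff_norm_sub_tendsto_zero.2 (squeeze_zero (fun _ => norm_nonneg _) (fun r => ?_) h)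
  have hi := fun r => integrable_fracKernel_smul hγ hδ hC hφ r
  have hk : Integrable fun τ => |fracKernel γ (r - τ) - fracKernel γ (t - τ)| *
      fracKernel δ (τ - s) := by
    refine (((integrable_fracKernel_conv hγ hδ s r).1.sub
      (integrable_fracKernel_conv hγ hδ s t).1).norm).congr (Filter.Eventually.of_forall fun τ => ?_)
    simp only [Pi.sub_apply, ← sub_mul, norm_mul, Real.norm_eq_abs,
      abs_of_nonneg (fracKernel_nonneg hδ (τ - s))]
  rw [fracInt, fracInt, ← integral_sub (hi r) (hi t), ← integral_const_mul]
  refine norm_integral_le_of_norm_le (hk.const_mul C) (Filter.Eventually.of_forall fun τ => ?_)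
  rw [← sub_smul, norm_smul, Real.norm_eq_abs]
  exact (mul_le_mul_of_nonneg_left (hC τ) (abs_nonneg _)).trans (le_of_eq (by ring))

end Continuity

/-! ### Existence and uniqueness of the fundamental solution -/

section Fundamental

variable {R : Type*} [NormedRing R] [NormedAlgebra ℝ R] [CompleteSpace R]
variable {α M : ℝ} {A : ℝ → R}

lemma continuousAt_fracInt_resolventKernel (hα₀ : 0 < α) (hα₁ : α < 1)
    (hA : StronglyMeasurable A) (hAM : ∀ t, ‖A t‖ ≤ M) {s t : ℝ} (hst : s < t) :
    ContinuousAt (fracInt α fun τ => A τ * resolventKernel α A τ s) t := by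
  obtain ⟨D, hD, h⟩ := exists_norm_resolventKernel_le (A := A) hα₀ hα₁ hAM (t + 1 - s)
  have hM : 0 ≤ M := (norm_nonneg _).trans (hAM 0)
  have hm : StronglyMeasurable fun τ => A τ * resolventKernel α A τ s :=
    hA.mul ((stronglyMeasurable_resolventKernel hα₀ hα₁ hA hAM).comp_measurable
      (measurable_id.prodMk measurable_const))
  -- The kernel bound holds only up to t + 1, so the density is cut off there; this leaves the
  -- integral unchanged near t.
  have hc := continuousAt_fracInt (C := M * D) (s := s) (t := t) hα₀ hα₀
    (hm.indicator (measurableSet_Iic (a := t + 1))) (fun τ => ?_) hst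
  · refine hc.congr ?_
    filter_upwards [Iio_mem_nhds (lt_add_one t)] with r hr
    refine integral_congr_ae (Filter.Eventually.of_forall fun τ => ?_)
    dsimp only
    rcases le_or_gt r τ with hτ | hτ
    · simp [fracKernel_of_nonpos α (sub_nonpos.2 hτ)]
    · rw [indicator_of_mem (show τ ∈ Iic (t + 1) from (hτ.trans hr).le)]
  · have h0 := fracKernel_nonneg hα₀ (τ - s)
    by_cases hτ : τ ∈ Iic (t + 1)
    · rw [indicator_of_mem hτ, mul_assoc]
      exact norm_mul_le_of_bound hAM (h τ s (by simp only [mem_Iic] at hτ; linarith)) τ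
    · rw [indicator_of_notMem hτ, norm_zero]
      positivity

/-- The fundamental solution built from the resolvent kernel. -/
noncomputable def fundSol (α : ℝ) (A : ℝ → R) (t s : ℝ) : R :=
  (1 / Real.Gamma α) • 1 +
    (t - s) ^ (1 - α) • fracInt α (fun τ => A τ * resolventKernel α A τ s) t

/-- Only for s < t: the kernel vanishes at t = s, whereas `fundSol`, built from the integral term,
has there the correct limit Id/Γ(α). -/
lemma rpow_smul_fundSol (hα₀ : 0 < α) (hα₁ : α < 1)
    (hA : StronglyMeasurable A) (hAM : ∀ t, ‖A t‖ ≤ M) {s t : ℝ} (hst : s < t) :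
    (t - s) ^ (α - 1) • fundSol α A t s = resolventKernel α A t s := by
  have h : 0 < t - s := sub_pos.2 hst
  rw [resolventKernel_eq hα₀ hα₁ hA hAM, fundSol, smul_add, smul_smul, smul_smul,
    ← Real.rpow_add h, fracKernel_of_pos α h]
  simp [div_eq_mul_inv]

lemma continuousOn_fundSol (hα₀ : 0 < α) (hα₁ : α < 1)
    (hA : StronglyMeasurable A) (hAM : ∀ t, ‖A t‖ ≤ M) (s ϑ : ℝ) :
    ContinuousOn (fun t => fundSol α A t s) (Icc s ϑ) := by
  intro t ht
  rcases ht.1.eq_or_lt with rfl | hst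
  -- At t = s: the integral is O((t - s)^(2α-1)), possibly unbounded, but the prefactor (t -
  -- s)^(1-α) turns this into O((t - s)^α).
  · obtain ⟨D, hD, h⟩ := exists_norm_resolventKernel_le (A := A) hα₀ hα₁ hAM (ϑ - s)
    have hM : 0 ≤ M := (norm_nonneg _).trans (hAM 0)
    refine continuousWithinAt_const.add ?_
    have h0 : Filter.Tendsto (fun t => M * D / Real.Gamma (α + α) * (t - s) ^ α)
        (nhdsWithin s (Icc s ϑ)) (nhds 0) := by
      have : ContinuousAt (fun t => M * D / Real.Gamma (α + α) * (t - s) ^ α) s := by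
        refine continuousAt_const.mul (ContinuousAt.rpow_const (by fun_prop) (Or.inr hα₀.le))
      have h1 := this.tendsto
      rw [sub_self, Real.zero_rpow hα₀.ne', mul_zero] at h1
      exact h1.mono_left nhdsWithin_le_nhds
    rw [ContinuousWithinAt, sub_self, Real.zero_rpow (by linarith), zero_smul]
    refine squeeze_zero_norm' ?_ h0
    filter_upwards [self_mem_nhdsWithin] with r hr
    rcases hr.1.eq_or_lt with rfl | hsr
    · rw [sub_self, Real.zero_rpow (by linarith), zero_smul, norm_zero, Real.zero_rpow hα₀.ne',
        mul_zero]
    · have hp : 0 < r - s := sub_pos.2 hsr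
      obtain ⟨hi, he⟩ := integrable_fracKernel_conv hα₀ hα₀ s r
      have hb : ‖fracInt α (fun τ => A τ * resolventKernel α A τ s) r‖ ≤
          M * D * fracKernel (α + α) (r - s) := by
        rw [← he, ← integral_const_mul]
        refine norm_integral_le_of_norm_le (hi.const_mul _)
          (Filter.Eventually.of_forall fun τ => ?_)
        rcases le_or_gt r τ with hτ | hτ
        · simp [fracKernel_of_nonpos α (sub_nonpos.2 hτ)]
        · exact (norm_fracKernel_smul_le hα₀ (norm_mul_le_of_bound hAM
            (h τ s (by linarith [hr.2])) τ) _).trans (le_of_eq (by ring))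
      rw [norm_smul, Real.norm_of_nonneg (by positivity)]
      refine (mul_le_mul_of_nonneg_left hb (by positivity)).trans (le_of_eq ?_)
      rw [fracKernel_of_pos _ hp]
      have e : (r - s) ^ α = (r - s) ^ (1 - α) * (r - s) ^ (α + α - 1) := by
        rw [← Real.rpow_add hp]; ring_nf
      rw [e]
      ring
  · have h1 := continuousAt_fracInt_resolventKernel hα₀ hα₁ hA hAM hst
    have h2 : ContinuousAt (fun t => (t - s) ^ (1 - α)) t :=
      ContinuousAt.rpow_const (by fun_prop) (Or.inl (sub_pos.2 hst).ne')
    exact (continuousAt_const.add (h2.smul h1)).continuousWithinAt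

lemma fundSol_eq (hα₀ : 0 < α) (hα₁ : α < 1)
    (hA : StronglyMeasurable A) (hAM : ∀ t, ‖A t‖ ≤ M) {s t : ℝ} (hst : s ≤ t) :
    fundSol α A t s = (1 / Real.Gamma α) • 1 + ((t - s) ^ (1 - α) / Real.Gamma α) •
      ∫ τ in s..t, ((t - τ) ^ (α - 1) * (τ - s) ^ (α - 1)) • (A τ * fundSol α A τ s) := by
  have hG := (Real.Gamma_pos_of_pos hα₀).ne'
  rw [fundSol, div_eq_mul_inv ((t - s) ^ (1 - α)), mul_smul, ← intervalIntegral.integral_smul]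
  congr 2
  refine (intervalIntegral_eq_integral hst (Filter.Eventually.of_forall fun τ hτ => ?_)
    fun τ hτ => ?_).symm
  · dsimp only
    rw [← rpow_smul_fundSol hα₀ hα₁ hA hAM hτ.1, mul_smul_comm, smul_smul, smul_smul,
      fracKernel_of_pos α (sub_pos.2 hτ.2)]
    congr 1
    ring
  · rcases le_or_gt τ s with h1 | h1
    · obtain ⟨_, _, h⟩ := exists_norm_resolventKernel_le (A := A) hα₀ hα₁ hAM (τ - s)
      have := h τ s le_rfl
      rw [fracKernel_of_nonpos α (by linarith), mul_zero, norm_le_zero_iff] at this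
      simp only [this, mul_zero, smul_zero]
    · rw [fracKernel_of_nonpos α (sub_nonpos.2 (not_lt.1 fun h2 => hτ ⟨h1, h2⟩)), zero_smul]

/-- Uniqueness for the resolvent equation. -/
lemma eq_resolventKernel_of_eq (hα₀ : 0 < α) (hα₁ : α < 1)
    (hA : StronglyMeasurable A) (hAM : ∀ t, ‖A t‖ ≤ M) {s ϑ B : ℝ} {g : ℝ → R}
    (hg : StronglyMeasurable g) (hgB : ∀ t, ‖g t‖ ≤ B * fracKernel α (t - s))
    (hgeq : ∀ t ∈ Ioc s ϑ, g t = fracKernel α (t - s) • 1 + fracInt α (fun τ => A τ * g τ) t)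
    {t : ℝ} (ht : t ≤ ϑ) : g t = resolventKernel α A t s := by
  have hM : 0 ≤ M := (norm_nonneg _).trans (hAM 0)
  obtain ⟨D, hD, h⟩ := exists_norm_resolventKernel_le (A := A) hα₀ hα₁ hAM (ϑ - s)
  have hB : ∀ t ≤ ϑ, ‖g t - resolventKernel α A t s‖ ≤ (B + D) * fracKernel α (t - s) :=
    fun t ht => (norm_sub_le _ _).trans (by linarith [hgB t, h t s (by linarith)])
  have h0 : ∀ t ≤ ϑ, t ≤ s → ‖g t - resolventKernel α A t s‖ = 0 := fun t ht hts => by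
    have := hB t ht
    rw [fracKernel_of_nonpos α (by linarith), mul_zero] at this
    exact le_antisymm this (norm_nonneg _)
  -- On (s, ϑ] the terms κ_α cancel and the difference d solves d = I^α(A d), so ‖d‖ satisfies the
  -- Gronwall inequality.
  refine sub_eq_zero.1 (norm_eq_zero.1 (eq_zero_of_le_fracKernel_integral hα₀ hα₁ hM
    (u := fun t => ‖g t - resolventKernel α A t s‖) (fun _ => norm_nonneg _) hB
    (fun t ht => ?_) ht))
  rcases le_or_gt t s with hts | hts
  · rw [h0 t ht hts]
    exact mul_nonneg hM (integral_nonneg fun τ =>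
      mul_nonneg (fracKernel_nonneg hα₀ _) (norm_nonneg _))
  · have hi1 : Integrable fun τ => fracKernel α (t - τ) • (A τ * g τ) :=
      integrable_fracKernel_smul (C := M * B) hα₀ hα₀ (fun τ =>
        (norm_mul_le_of_bound hAM (hgB τ) τ).trans (le_of_eq (by ring))) (hA.mul hg) t
    have hi2 := integrable_fracKernel_smul_resolventKernel hα₀ hα₁ hA hAM t s
    have hi3 : Integrable fun τ => fracKernel α (t - τ) * ‖g τ - resolventKernel α A τ s‖ := by
      have hm := hg.sub ((stronglyMeasurable_resolventKernel hα₀ hα₁ hA hAM).comp_measurable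
        (measurable_id.prodMk (measurable_const (a := s))))
      refine ((integrable_fracKernel_conv hα₀ hα₀ s t).1.const_mul (B + D)).mono'
        ((Measurable.stronglyMeasurable (by fun_prop)).mul hm.norm).aestronglyMeasurable
        (Filter.Eventually.of_forall fun τ => ?_)
      rcases le_or_gt t τ with hτ | hτ
      · simp [fracKernel_of_nonpos α (sub_nonpos.2 hτ)]
      · rw [norm_mul, norm_norm, Real.norm_of_nonneg (fracKernel_nonneg hα₀ _)]
        exact (mul_le_mul_of_nonneg_left (hB τ (by linarith)) (fracKernel_nonneg hα₀ _)).trans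
          (le_of_eq (by ring))
    rw [hgeq t ⟨hts, ht⟩, resolventKernel_eq hα₀ hα₁ hA hAM t s, add_sub_add_left_eq_sub, fracInt,
      fracInt, ← integral_sub hi1 hi2, ← integral_const_mul]
    refine norm_integral_le_of_norm_le (hi3.const_mul M) (Filter.Eventually.of_forall fun τ => ?_)
    rw [← smul_sub, ← mul_sub]
    exact (norm_fracKernel_smul_le hα₀ (norm_mul_le_of_bound hAM le_rfl τ) _).trans
      (le_of_eq (by ring))

/-- A continuous f is bounded on [s, ϑ], so (t - s)^(α-1) f(t) is dominated by κ_α and solves the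
resolvent equation; uniqueness identifies it with R. -/
lemma rpow_smul_eq_resolventKernel (hα₀ : 0 < α) (hα₁ : α < 1)
    (hA : StronglyMeasurable A) (hAM : ∀ t, ‖A t‖ ≤ M) {s ϑ : ℝ} (hsϑ : s ≤ ϑ) {f : ℝ → R}
    (hf : ContinuousOn f (Icc s ϑ))
    (hfeq : ∀ t ∈ Icc s ϑ, f t = (1 / Real.Gamma α) • 1 + ((t - s) ^ (1 - α) / Real.Gamma α) •
      ∫ τ in s..t, ((t - τ) ^ (α - 1) * (τ - s) ^ (α - 1)) • (A τ * f τ))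
    {t : ℝ} (ht : t ∈ Ioc s ϑ) : (t - s) ^ (α - 1) • f t = resolventKernel α A t s := by
  have hG := Real.Gamma_pos_of_pos hα₀
  obtain ⟨B, hB⟩ := isCompact_Icc.exists_bound_of_continuousOn hf
  have hB0 : 0 ≤ B := (norm_nonneg _).trans (hB s (left_mem_Icc.2 hsϑ))
  -- Nothing is known of f outside [s, ϑ]; a continuous extension supplies measurability on the
  -- line.
  set f' : ℝ → R := IccExtend hsϑ ((Icc s ϑ).domRestrict f)
  have hf' : ∀ t ∈ Ioc s ϑ, f' t = f t := fun t ht =>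
    IccExtend_of_mem hsϑ _ (Ioc_subset_Icc_self ht)
  have hf'c : Continuous f' := hf.domRestrict.Icc_extend'
  set g : ℝ → R := (Ioc s ϑ).indicator fun τ => (Real.Gamma α * fracKernel α (τ - s)) • f' τ
  have hgs : StronglyMeasurable g :=
    ((Measurable.stronglyMeasurable (by fun_prop)).smul hf'c.stronglyMeasurable).indicator
      measurableSet_Ioc
  have hgi : ∀ t ∈ Ioc s ϑ, g t = (Real.Gamma α * fracKernel α (t - s)) • f' t := fun t ht =>
    indicator_of_mem ht _
  have hg0 : ∀ t ∉ Ioc s ϑ, g t = 0 := fun t ht => indicator_of_notMem ht _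
  have hgm : ∀ t ∈ Ioc s ϑ, g t = (t - s) ^ (α - 1) • f t := fun t ht => by
    rw [hgi t ht, hf' t ht, fracKernel_of_pos α (sub_pos.2 ht.1)]
    congr 1
    field_simp
  have hgB : ∀ t, ‖g t‖ ≤ Real.Gamma α * B * fracKernel α (t - s) := fun t => by
    have h0 := fracKernel_nonneg hα₀ (t - s)
    by_cases h : t ∈ Ioc s ϑ
    · rw [hgi t h, norm_smul, Real.norm_of_nonneg (by positivity), hf' t h,
        mul_right_comm]
      gcongr
      exact hB t (Ioc_subset_Icc_self h)
    · rw [hg0 t h, norm_zero]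
      positivity
  rw [← hgm t ht]
  refine eq_resolventKernel_of_eq (ϑ := ϑ) hα₀ hα₁ hA hAM hgs hgB (fun t ht => ?_) ht.2
  have hp : 0 < t - s := sub_pos.2 ht.1
  have hint : ∫ τ in s..t, ((t - τ) ^ (α - 1) * (τ - s) ^ (α - 1)) • (A τ * f τ) =
      Real.Gamma α • fracInt α (fun τ => A τ * g τ) t := by
    rw [fracInt, ← integral_smul]
    refine intervalIntegral_eq_integral ht.1.le (Filter.Eventually.of_forall fun τ hτ => ?_)
      fun τ hτ => ?_
    · rw [hgm τ ⟨hτ.1, hτ.2.le.trans ht.2⟩, mul_smul_comm, smul_smul, smul_smul,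
        fracKernel_of_pos α (sub_pos.2 hτ.2)]
      congr 1
      field_simp
    · rcases le_or_gt τ s with h1 | h1
      · rw [hg0 τ fun h => h1.not_gt h.1, mul_zero, smul_zero,
          smul_zero]
      · rw [fracKernel_of_nonpos α (sub_nonpos.2 (not_lt.1 fun h2 => hτ ⟨h1, h2⟩)), zero_smul,
          smul_zero]
  have e1 : (t - s) ^ (α - 1) * ((t - s) ^ (1 - α) / Real.Gamma α) * Real.Gamma α = 1 := by
    rw [mul_assoc, div_mul_cancel₀ _ hG.ne', ← Real.rpow_add hp]
    simp
  rw [hgm t ht, hfeq t (Ioc_subset_Icc_self ht), hint, smul_add, smul_smul, smul_smul, smul_smul,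
    e1, one_smul, fracKernel_of_pos α hp, mul_one_div]

end Fundamental

/-! ### Bounded representatives and the Caputo derivative -/

section Caputo

variable {X : Type*} [NormedAddCommGroup X]

/-- Truncate a measurable representative at the essential supremum and outside (a, b). All later
estimates can then be pointwise on the whole line. -/
lemma IsLinf.exists_bounded {a b : ℝ} {φ : ℝ → X} (h : IsLinf a b φ) :
    ∃ (ψ : ℝ → X) (M : ℝ), 0 ≤ M ∧ StronglyMeasurable ψ ∧ (∀ t, ‖ψ t‖ ≤ M) ∧
      (∀ t ∉ Ioo a b, ψ t = 0) ∧ ∀ᵐ t, t ∈ Ioo a b → φ t = ψ t := by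
  set φ₀ := h.1.mk φ
  have hφ₀ : StronglyMeasurable φ₀ := h.1.stronglyMeasurable_mk
  set N := eLpNormEssSup φ (volume.restrict (Icc a b))
  have hN : N ≠ ∞ := by
    have := h.2.ne
    rwa [eLpNorm_exponent_top] at this
  set S := Ioo a b ∩ {t | ‖φ₀ t‖ ≤ N.toReal}
  have hS : MeasurableSet S := measurableSet_Ioo.inter
    (measurableSet_le hφ₀.norm.measurable measurable_const)
  refine ⟨S.indicator φ₀, N.toReal, ENNReal.toReal_nonneg, hφ₀.indicator hS, fun t => ?_,
    fun t ht => indicator_of_notMem (fun hs => ht hs.1) _, ?_⟩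
  · by_cases hs : t ∈ S
    · rw [indicator_of_mem hs]
      exact hs.2
    · rw [indicator_of_notMem hs, norm_zero]
      exact ENNReal.toReal_nonneg
  · have h1 := (ae_restrict_iff' measurableSet_Icc).1 h.1.ae_eq_mk
    have h2 := (ae_restrict_iff' measurableSet_Icc).1
      (ae_le_eLpNormEssSup (f := φ) (μ := volume.restrict (Icc a b)))
    filter_upwards [h1, h2] with t ht1 ht2 ht
    have e := ht1 (Ioo_subset_Icc_self ht)
    have hs : t ∈ S := by
      refine ⟨ht, ?_⟩
      have h3 := (ENNReal.toReal_le_toReal enorm_ne_top hN).2 (ht2 (Ioo_subset_Icc_self ht))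
      rwa [toReal_enorm, e] at h3
    rw [indicator_of_mem hs, e]

/-- As κ₁ is the indicator of (0, ∞), boundedness and vanishing left of a merge into one bound of
the form used for `fracInt`. -/
lemma norm_le_mul_fracKernel_one {a M : ℝ} {ψ : ℝ → X} (h : ∀ t, ‖ψ t‖ ≤ M)
    (h0 : ∀ t ≤ a, ψ t = 0) (t : ℝ) : ‖ψ t‖ ≤ M * fracKernel 1 (t - a) := by
  rw [fracKernel_one]
  split_ifs with ht
  · simpa using h t
  · rw [h0 t (by linarith), norm_zero, mul_zero]

lemma norm_le_of_norm_le_mul_fracKernel_one {a M : ℝ} {ψ : ℝ → X}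
    (h : ∀ t, ‖ψ t‖ ≤ M * fracKernel 1 (t - a)) (t : ℝ) : ‖ψ t‖ ≤ |M| := by
  have := h t
  rw [fracKernel_one] at this
  split_ifs at this
  · exact this.trans (by simpa using le_abs_self M)
  · exact this.trans (by simp)

lemma eq_zero_of_norm_le_mul_fracKernel {γ a C t : ℝ} {v : X}
    (h : ‖v‖ ≤ C * fracKernel γ (t - a)) (ht : t ≤ a) : v = 0 := by
  rwa [fracKernel_of_nonpos γ (by linarith), mul_zero, norm_le_zero_iff] at h

variable [NormedSpace ℝ X]

lemma fracInt_one_eq {a t : ℝ} (hat : a ≤ t) {ψ : ℝ → X} (h0 : ∀ τ ≤ a, ψ τ = 0) :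
    fracInt 1 ψ t = ∫ τ in a..t, ψ τ := by
  refine (intervalIntegral_eq_integral hat (Filter.Eventually.of_forall fun τ hτ => ?_)
    fun τ hτ => ?_).symm
  · rw [fracKernel_one, if_pos (sub_pos.2 hτ.2), one_smul]
  · rcases le_or_gt τ a with h1 | h1
    · rw [h0 τ h1, smul_zero]
    · rw [fracKernel_of_nonpos 1 (sub_nonpos.2 (not_lt.1 fun h2 => hτ ⟨h1, h2⟩)), zero_smul]

variable [CompleteSpace X]

/-- If `x = x(a) + I^α ψ` on `[a, c]`, the Caputo derivative of `x` is `ψ` almost everywhere. -/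
lemma ae_hasCaputoDerivAt {α a c C : ℝ} (hα₀ : 0 < α) (hα₁ : α < 1) {x ψ : ℝ → X}
    (hψ : StronglyMeasurable ψ) (hC : ∀ t, ‖ψ t‖ ≤ C * fracKernel 1 (t - a))
    (hx : ∀ t ∈ Icc a c, x t - x a = fracInt α ψ t) :
    ∀ᵐ t, t ∈ Ioo a c → HasCaputoDerivAt α a x (ψ t) t := by
  have h1 : 0 < 1 - α := by linarith
  have h0 : ∀ t ≤ a, ψ t = 0 := fun t ht => eq_zero_of_norm_le_mul_fracKernel (hC t) ht
  have hI0 : ∀ t ≤ a, fracInt α ψ t = 0 := fun t ht =>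
    eq_zero_of_norm_le_mul_fracKernel (norm_fracInt_le hα₀ one_pos hC t) ht
  -- I^(1-α) I^α = I^1, so the function to differentiate is a primitive of ψ and Lebesgue's
  -- differentiation theorem applies.
  have key : ∀ t ∈ Icc a c, rlIntegral (1 - α) a (fun τ => x τ - x a) t = ∫ τ in a..t, ψ τ := by
    intro t ht
    rw [rlIntegral_eq_fracInt (ψ := fracInt α ψ) ht.1 (Filter.Eventually.of_forall fun τ hτ =>
      hx τ ⟨hτ.1.le, hτ.2.le.trans ht.2⟩) hI0, fracInt_fracInt h1 one_pos hC hψ hα₀,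
      sub_add_cancel, fracInt_one_eq ht.1 h0]
  have hloc : LocallyIntegrable ψ volume := (locallyIntegrable_const |C|).mono
    hψ.aestronglyMeasurable (Filter.Eventually.of_forall fun t =>
      (norm_le_of_norm_le_mul_fracKernel_one hC t).trans (Real.le_norm_self _))
  filter_upwards [LocallyIntegrable.ae_hasDerivAt_integral hloc] with t ht htm
  refine (ht a).congr_of_eventuallyEq ?_
  filter_upwards [Ioo_mem_nhds htm.1 htm.2] with τ hτ using key τ (Ioo_subset_Icc_self hτ)

end Caputo

/-! ### The history as a forcing term -/

section Memory

/-- The kernel through which the history `φ = D^α w` on `(-∞, c)` acts as a forcing after `c`. -/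
noncomputable def memoryKernel (α c r σ : ℝ) : ℝ :=
  if σ < c ∧ c < r then (r - c) ^ (1 - α) * (c - σ) ^ (α - 1) / (r - σ) /
    (Real.Gamma α * Real.Gamma (1 - α)) else 0

variable {α c : ℝ}

lemma measurable_memoryKernel : Measurable (Function.uncurry (memoryKernel α c)) := by
  refine Measurable.ite ?_ (by fun_prop) measurable_const
  exact (measurableSet_lt measurable_snd measurable_const).inter
    (measurableSet_lt measurable_const measurable_fst)

lemma memoryKernel_of_lt {σ r : ℝ} (hσ : σ < c) (hr : c < r) : memoryKernel α c r σ =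
    (r - c) ^ (1 - α) * (c - σ) ^ (α - 1) / (r - σ) / (Real.Gamma α * Real.Gamma (1 - α)) :=
  if_pos ⟨hσ, hr⟩

lemma memoryKernel_nonneg (hα₀ : 0 < α) (hα₁ : α < 1) (r σ : ℝ) : 0 ≤ memoryKernel α c r σ := by
  have h1 := Real.Gamma_pos_of_pos hα₀
  have h2 := Real.Gamma_pos_of_pos (show 0 < 1 - α by linarith)
  unfold memoryKernel
  split_ifs with h
  · have : 0 < r - c := sub_pos.2 h.2
    have : 0 < c - σ := sub_pos.2 h.1
    have : 0 < r - σ := by linarith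
    positivity
  · exact le_rfl

lemma hasDerivAt_const_sub_rpow {a p v : ℝ} (h : v < a) :
    HasDerivAt (fun v => (a - v) ^ p) (-(p * (a - v) ^ (p - 1))) v := by
  have := ((hasDerivAt_id v).const_sub a).rpow_const (p := p) (Or.inl (sub_pos.2 h).ne')
  exact this.congr_deriv (by simp)

lemma hasDerivAt_sub_const_rpow {a p v : ℝ} (h : a < v) :
    HasDerivAt (fun v => (v - a) ^ p) (p * (v - a) ^ (p - 1)) v := by
  have := ((hasDerivAt_id v).sub_const a).rpow_const (p := p) (Or.inl (sub_pos.2 h).ne')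
  exact this.congr_deriv (by simp)

/-- The derivative of `κ_α(c - σ) - κ_α(r - σ)` with respect to `r`, for `r > c`. -/
noncomputable def memoryDensity (α c σ r : ℝ) : ℝ :=
  if c < r then (1 - α) * (r - σ) ^ (α - 2) / Real.Gamma α else 0

lemma memoryDensity_of_le (σ : ℝ) {r : ℝ} (hr : r ≤ c) : memoryDensity α c σ r = 0 :=
  if_neg hr.not_gt

lemma stronglyMeasurable_memoryDensity (σ : ℝ) : StronglyMeasurable (memoryDensity α c σ) :=
  (Measurable.ite measurableSet_Ioi (by fun_prop) measurable_const).stronglyMeasurable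

lemma norm_memoryDensity_le (hα₀ : 0 < α) (hα₁ : α < 1) {σ : ℝ} (hσ : σ < c) (r : ℝ) :
    ‖memoryDensity α c σ r‖ ≤
      ((1 - α) * (c - σ) ^ (α - 2) / Real.Gamma α) * fracKernel 1 (r - c) := by
  have h1 := Real.Gamma_pos_of_pos hα₀
  have h2 : 0 < 1 - α := by linarith
  have h3 : 0 < c - σ := sub_pos.2 hσ
  refine norm_le_mul_fracKernel_one (fun t => ?_) (fun t ht => memoryDensity_of_le σ ht) r
  unfold memoryDensity
  split_ifs with ht
  · have h4 : 0 < t - σ := by linarith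
    rw [Real.norm_of_nonneg (by positivity)]
    gcongr 1
    exact mul_le_mul_of_nonneg_left
      (Real.rpow_le_rpow_of_nonpos h3 (by linarith) (by linarith)) h2.le
  · rw [norm_zero]
    positivity

/-- The integrand has the primitive -(r - v)^(1-α) (v - σ)^(α-1)/D with D = Γ(α)Γ(1-α)(r - σ),
because (v - σ) + (r - v) = r - σ. It vanishes at v = r, and its value at v = c produces the memory
kernel. -/
lemma fracInt_memoryDensity (hα₀ : 0 < α) (hα₁ : α < 1) {σ : ℝ} (hσ : σ < c) (r : ℝ) :
    fracInt (1 - α) (memoryDensity α c σ) r = memoryKernel α c r σ := by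
  have h1 := Real.Gamma_pos_of_pos hα₀
  have h2 : 0 < 1 - α := by linarith
  have h3 := Real.Gamma_pos_of_pos h2
  have hb := norm_memoryDensity_le hα₀ hα₁ hσ
  rcases le_or_gt r c with hr | hr
  · rw [eq_zero_of_norm_le_mul_fracKernel (norm_fracInt_le h2 one_pos hb r) hr, memoryKernel,
      if_neg fun h => hr.not_gt h.2]
  have hrσ : 0 < r - σ := by linarith
  set D : ℝ := Real.Gamma α * Real.Gamma (1 - α) * (r - σ)
  have hD : 0 < D := by positivity
  have hderiv : ∀ v ∈ Ioo c r, HasDerivAt (fun v => -((r - v) ^ (1 - α) * (v - σ) ^ (α - 1)) / D)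
      (fracKernel (1 - α) (r - v) • memoryDensity α c σ v) v := by
    intro v hv
    have ha : 0 < r - v := sub_pos.2 hv.2
    have hc : 0 < v - σ := by linarith [hv.1]
    refine (((hasDerivAt_const_sub_rpow (p := 1 - α) hv.2).mul
      (hasDerivAt_sub_const_rpow (p := α - 1) (hσ.trans hv.1))).neg.div_const D).congr_deriv ?_
    rw [smul_eq_mul, fracKernel_of_pos _ ha, memoryDensity, if_pos hv.1]
    have e1 : (r - v) ^ (1 - α) = (r - v) ^ (1 - α - 1) * (r - v) := by
      rw [← Real.rpow_add_one ha.ne']; ring_nf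
    have e2 : (v - σ) ^ (α - 1) = (v - σ) ^ (α - 2) * (v - σ) := by
      rw [← Real.rpow_add_one hc.ne']; ring_nf
    have e3 : α - 1 - 1 = α - 2 := by ring
    rw [e3, e1, e2]
    simp only [D]
    field_simp
    ring
  have hcont : ContinuousOn (fun v => -((r - v) ^ (1 - α) * (v - σ) ^ (α - 1)) / D)
      (Icc c r) := by
    refine ContinuousOn.div_const (ContinuousOn.neg (ContinuousOn.mul ?_ ?_)) D
    · exact ContinuousOn.rpow_const (by fun_prop) fun v _ => Or.inr h2.le
    · exact ContinuousOn.rpow_const (by fun_prop) fun v hv =>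
        Or.inl (by linarith [hv.1] : 0 < v - σ).ne'
  have hint := integrable_fracKernel_smul h2 one_pos hb (stronglyMeasurable_memoryDensity σ) r
  have hF := intervalIntegral.integral_eq_sub_of_hasDerivAt_of_le hr.le hcont hderiv
    (intervalIntegrable_of_integrable hr.le (Filter.Eventually.of_forall fun v _ => rfl) hint)
  rw [intervalIntegral_eq_integral hr.le (k := fun v =>
    fracKernel (1 - α) (r - v) • memoryDensity α c σ v) (Filter.Eventually.of_forall fun v _ => rfl)
    fun v hv => ?_] at hF
  · rw [fracInt, hF, sub_self, Real.zero_rpow h2.ne', memoryKernel_of_lt hσ hr]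
    simp only [D]
    field_simp
    ring
  · rcases le_or_gt v c with h4 | h4
    · rw [memoryDensity_of_le σ h4, smul_zero]
    · rw [fracKernel_of_nonpos _ (sub_nonpos.2 (not_lt.1 fun h5 => hv ⟨h4, h5⟩)), zero_smul]

lemma fracInt_one_memoryDensity (hα₀ : 0 < α) {σ : ℝ} (hσ : σ < c) {t : ℝ}
    (ht : c ≤ t) :
    fracInt 1 (memoryDensity α c σ) t = fracKernel α (c - σ) - fracKernel α (t - σ) := by
  have h1 := Real.Gamma_pos_of_pos hα₀
  rw [fracInt_one_eq ht fun τ hτ => memoryDensity_of_le σ hτ]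
  have hpos : ∀ v ∈ Icc c t, 0 < v - σ := fun v hv => by linarith [hv.1]
  have hd : ∫ v in c..t, memoryDensity α c σ v =
      ∫ v in c..t, (1 - α) * (v - σ) ^ (α - 2) / Real.Gamma α := by
    rw [intervalIntegral.integral_of_le ht, intervalIntegral.integral_of_le ht]
    exact setIntegral_congr_fun measurableSet_Ioc fun v hv => if_pos hv.1
  rw [hd, intervalIntegral.integral_eq_sub_of_hasDerivAt_of_le (f := fun v =>
    -(v - σ) ^ (α - 1) / Real.Gamma α) ht, fracKernel_of_pos α (sub_pos.2 hσ),
    fracKernel_of_pos α (show 0 < t - σ by linarith)]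
  · ring
  · exact ((ContinuousOn.rpow_const (by fun_prop) fun v hv => Or.inl (hpos v hv).ne').neg).div_const
      _
  · intro v hv
    refine ((hasDerivAt_sub_const_rpow (p := α - 1) (hσ.trans hv.1)).neg.div_const
      _).congr_deriv ?_
    rw [show α - 1 - 1 = α - 2 by ring]
    ring
  · refine ContinuousOn.intervalIntegrable ?_
    rw [uIcc_of_le ht]
    exact (continuousOn_const.mul
      (ContinuousOn.rpow_const (by fun_prop) fun v hv => Or.inl (hpos v hv).ne')).div_const _

/-- The memory kernel is I^(1-α) of the memory density, so the semigroup law reduces its I^α to an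
ordinary primitive of that density. -/
lemma fracInt_memoryKernel (hα₀ : 0 < α) (hα₁ : α < 1) {σ : ℝ} (hσ : σ < c) {t : ℝ}
    (ht : c ≤ t) :
    fracInt α (fun r => memoryKernel α c r σ) t = fracKernel α (c - σ) - fracKernel α (t - σ) := by
  rw [← fracInt_one_memoryDensity hα₀ hσ ht, ← funext (fracInt_memoryDensity hα₀ hα₁ hσ),
    fracInt_fracInt hα₀ one_pos (norm_memoryDensity_le hα₀ hα₁ hσ)
      (stronglyMeasurable_memoryDensity σ) (by linarith), add_sub_cancel]

/-- The total mass of the memory kernel is bounded uniformly in `r`. -/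
lemma integral_memoryKernel_le (hα₀ : 0 < α) (hα₁ : α < 1) :
    ∃ C, 0 ≤ C ∧ ∀ r, Integrable (fun σ => memoryKernel α c r σ) ∧
      ∫ σ, memoryKernel α c r σ ≤ C := by
  have h1 := Real.Gamma_pos_of_pos hα₀
  have h2 : 0 < 1 - α := by linarith
  have h3 := Real.Gamma_pos_of_pos h2
  set D : ℝ := Real.Gamma α * Real.Gamma (1 - α)
  have hD : 0 < D := by positivity
  refine ⟨(1 / α + 1 / (1 - α)) / D, by positivity, fun r => ?_⟩
  rcases le_or_gt r c with hr | hr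
  · have : (fun σ => memoryKernel α c r σ) = fun _ => 0 := by
      ext σ
      exact if_neg fun h => hr.not_gt h.2
    rw [this]
    refine ⟨integrable_zero _ _ _, ?_⟩
    rw [integral_zero]
    positivity
  set v := r - c
  have hv : 0 < v := sub_pos.2 hr
  -- With p = c - σ the kernel is v^(1-α) p^(α-1)/(v + p) up to the factor D. Replacing v + p by the
  -- larger of v and p gives g₁ for p ≤ v and g₂ for p > v; their integrals 1/α and 1/(1-α) are
  -- scale invariant, whence uniformity in r.
  set g₁ : ℝ → ℝ := (Ioc 0 v).indicator fun p => v ^ (-α) * p ^ (α - 1)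
  set g₂ : ℝ → ℝ := (Ioi v).indicator fun p => v ^ (1 - α) * p ^ (α - 2)
  have hi1' : IntervalIntegrable (fun p : ℝ => p ^ (α - 1)) volume 0 v :=
    intervalIntegral.intervalIntegrable_rpow' (by linarith)
  have hi1 : Integrable g₁ := by
    rw [integrable_indicator_iff measurableSet_Ioc]
    exact (((intervalIntegrable_iff_integrableOn_Ioc_of_le hv.le).1 hi1').const_mul _)
  have hi2 : Integrable g₂ := by
    rw [integrable_indicator_iff measurableSet_Ioi]
    exact (integrableOn_Ioi_rpow_of_lt (by linarith) hv).const_mul _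
  have he1 : ∫ p, g₁ p = 1 / α := by
    rw [integral_indicator measurableSet_Ioc, integral_const_mul,
      ← intervalIntegral.integral_of_le hv.le, integral_rpow (Or.inl (by linarith)),
      sub_add_cancel, Real.zero_rpow hα₀.ne', sub_zero, ← mul_div_assoc, ← Real.rpow_add hv]
    simp
  have he2 : ∫ p, g₂ p = 1 / (1 - α) := by
    rw [integral_indicator measurableSet_Ioi, integral_const_mul,
      integral_Ioi_rpow_of_lt (by linarith) hv, show α - 2 + 1 = -(1 - α) by ring, neg_div_neg_eq,
      ← mul_div_assoc, ← Real.rpow_add hv]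
    simp
  have hint : Integrable fun σ => (g₁ (c - σ) + g₂ (c - σ)) / D :=
    ((hi1.add hi2).comp_sub_left c).div_const D
  have hle : ∀ σ, memoryKernel α c r σ ≤ (g₁ (c - σ) + g₂ (c - σ)) / D := by
    intro σ
    rcases le_or_gt c σ with hσ | hσ
    · rw [memoryKernel, if_neg fun h => hσ.not_gt h.1]
      have e1 : g₁ (c - σ) = 0 := indicator_of_notMem (fun h => by linarith [h.1]) _
      have e2 : g₂ (c - σ) = 0 := indicator_of_notMem (fun h => by
        simp only [mem_Ioi] at h; linarith) _
      rw [e1, e2]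
      simp
    · rw [memoryKernel_of_lt hσ hr]
      have hp : 0 < c - σ := sub_pos.2 hσ
      have hs : 0 < r - σ := by linarith
      refine div_le_div_of_nonneg_right ?_ hD.le
      change v ^ (1 - α) * (c - σ) ^ (α - 1) / (r - σ) ≤ _
      rcases le_or_gt (c - σ) v with hpv | hpv
      · have e1 : g₁ (c - σ) = v ^ (-α) * (c - σ) ^ (α - 1) := 
            indicator_of_mem (show c - σ ∈ Ioc 0 v from ⟨hp, hpv⟩) _
        have e2 : g₂ (c - σ) = 0 := indicator_of_notMem (fun h => hpv.not_gt h) _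
        rw [e1, e2, add_zero, div_le_iff₀ hs, show 1 - α = -α + 1 by ring,
          Real.rpow_add_one hv.ne', mul_right_comm]
        gcongr
        linarith
      · have e1 : g₁ (c - σ) = 0 := indicator_of_notMem (fun h => hpv.not_ge h.2) _
        have e2 : g₂ (c - σ) = v ^ (1 - α) * (c - σ) ^ (α - 2) := indicator_of_mem hpv _
        rw [e1, e2, zero_add, div_le_iff₀ hs, show α - 1 = α - 2 + 1 by ring,
          Real.rpow_add_one hp.ne', ← mul_assoc]
        gcongr
  have hm : StronglyMeasurable fun σ => memoryKernel α c r σ :=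
    (measurable_memoryKernel.comp (measurable_const.prodMk measurable_id)).stronglyMeasurable
  have hi := hint.mono' hm.aestronglyMeasurable (Filter.Eventually.of_forall fun σ => by
    rw [Real.norm_of_nonneg (memoryKernel_nonneg hα₀ hα₁ r σ)]
    exact hle σ)
  refine ⟨hi, (integral_mono hi hint hle).trans (le_of_eq ?_)⟩
  rw [integral_div, integral_sub_left_eq_self (fun p => g₁ p + g₂ p) volume c,
    integral_add hi1 hi2, he1, he2]

variable {X : Type*} [NormedAddCommGroup X] [NormedSpace ℝ X] {φ : ℝ → X}

/-- The forcing after `c` produced by the history `φ = D^α w` before `c`. -/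
noncomputable def memoryForcing (α c : ℝ) (φ : ℝ → X) (r : ℝ) : X :=
  -∫ σ, memoryKernel α c r σ • φ σ

lemma stronglyMeasurable_memoryForcing (hφ : StronglyMeasurable φ) :
    StronglyMeasurable (memoryForcing α c φ) := by
  refine (StronglyMeasurable.integral_prod_right
    (f := fun r σ => memoryKernel α c r σ • φ σ) ?_).neg
  exact measurable_memoryKernel.stronglyMeasurable.smul (hφ.comp_measurable measurable_snd)

lemma exists_norm_memoryForcing_le (hα₀ : 0 < α) (hα₁ : α < 1) {M : ℝ} (hM : ∀ t, ‖φ t‖ ≤ M) :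
    ∃ C, 0 ≤ C ∧ ∀ r, ‖memoryForcing α c φ r‖ ≤ C * fracKernel 1 (r - c) := by
  have hM0 : 0 ≤ M := (norm_nonneg _).trans (hM 0)
  obtain ⟨C, hC, h⟩ := integral_memoryKernel_le (c := c) hα₀ hα₁
  refine ⟨C * M, by positivity, norm_le_mul_fracKernel_one (fun r => ?_) fun r hr => ?_⟩
  · rw [memoryForcing, norm_neg]
    refine (norm_integral_le_of_norm_le ((h r).1.mul_const M)
      (Filter.Eventually.of_forall fun σ => ?_)).trans ?_
    · rw [norm_smul, Real.norm_of_nonneg (memoryKernel_nonneg hα₀ hα₁ r σ)]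
      exact mul_le_mul_of_nonneg_left (hM σ) (memoryKernel_nonneg hα₀ hα₁ r σ)
    · rw [integral_mul_const]
      exact mul_le_mul_of_nonneg_right (h r).2 hM0
  · have : ∀ σ, memoryKernel α c r σ = 0 := fun σ => if_neg fun h => hr.not_gt h.2
    simp [memoryForcing, this]

/-- Fubini reduces the claim to `fracInt_memoryKernel` for each σ < c. It rewrites the influence of
the past as a fractional integral started at c. -/
lemma fracInt_memoryForcing [CompleteSpace X] (hα₀ : 0 < α) (hα₁ : α < 1)
    (hφ : StronglyMeasurable φ) {M a : ℝ}
    (hM : ∀ t, ‖φ t‖ ≤ M * fracKernel 1 (t - a)) (hφ0 : ∀ t, c ≤ t → φ t = 0) {t : ℝ}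
    (ht : c ≤ t) :
    fracInt α (memoryForcing α c φ) t = fracInt α φ t - fracInt α φ c := by
  have hmN : StronglyMeasurable (Function.uncurry fun r σ =>
      fracKernel α (t - r) • memoryKernel α c r σ • φ σ) :=
    (Measurable.stronglyMeasurable (by fun_prop)).smul
      (measurable_memoryKernel.stronglyMeasurable.smul (hφ.comp_measurable measurable_snd))
  have hN : ∀ σ < c, Integrable fun r => fracKernel α (t - r) • memoryKernel α c r σ := by
    intro σ hσ
    have hb := norm_fracInt_le (show 0 < 1 - α by linarith) one_pos
      (norm_memoryDensity_le hα₀ hα₁ hσ)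
    simp only [fracInt_memoryDensity hα₀ hα₁ hσ] at hb
    exact integrable_fracKernel_smul hα₀ (by linarith) hb
      (measurable_memoryKernel.comp (measurable_id.prodMk measurable_const)).stronglyMeasurable t
  have hi1 := integrable_fracKernel_smul hα₀ one_pos hM hφ t
  have hi2 := integrable_fracKernel_smul hα₀ one_pos hM hφ c
  have hint : Integrable (Function.uncurry fun r σ =>
      fracKernel α (t - r) • memoryKernel α c r σ • φ σ) (volume.prod volume) := by
    rw [integrable_prod_iff' hmN.aestronglyMeasurable]
    -- The kernels are nonnegative, so the same identity evaluates the inner integral of norms as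
    -- (κ_α(c - σ) - κ_α(t - σ)) ‖φ σ‖.
    refine ⟨Filter.Eventually.of_forall fun σ => ?_,
      (hi2.norm.sub hi1.norm).congr (Filter.Eventually.of_forall fun σ => ?_)⟩
    · simp only [Function.uncurry_apply_pair]
      rcases le_or_gt c σ with hσ | hσ
      · simp [hφ0 σ hσ]
      · simpa only [smul_eq_mul, smul_smul] using (hN σ hσ).smul_const (φ σ)
    · simp only [Function.uncurry_apply_pair, Pi.sub_apply, norm_smul,
        Real.norm_of_nonneg (fracKernel_nonneg hα₀ _),
        Real.norm_of_nonneg (memoryKernel_nonneg hα₀ hα₁ _ _)]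
      rcases le_or_gt c σ with hσ | hσ
      · simp [hφ0 σ hσ]
      · have := fracInt_memoryKernel hα₀ hα₁ hσ ht
        simp only [fracInt, smul_eq_mul] at this
        simp_rw [← mul_assoc]
        rw [integral_mul_const, this]
        ring
  calc fracInt α (memoryForcing α c φ) t
      = -∫ r, ∫ σ, fracKernel α (t - r) • memoryKernel α c r σ • φ σ := by
        simp_rw [fracInt, memoryForcing, smul_neg, integral_smul, integral_neg]
    _ = -∫ σ, ∫ r, fracKernel α (t - r) • memoryKernel α c r σ • φ σ := by
        rw [integral_integral_swap hint]
    _ = -∫ σ, (fracKernel α (c - σ) • φ σ - fracKernel α (t - σ) • φ σ) := by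
        congr 1
        refine integral_congr_ae (Filter.Eventually.of_forall fun σ => ?_)
        dsimp only
        rcases le_or_gt c σ with hσ | hσ
        · simp [hφ0 σ hσ]
        · rw [← sub_smul, ← fracInt_memoryKernel hα₀ hα₁ hσ ht, fracInt, ← integral_smul_const]
          simp_rw [smul_smul, smul_eq_mul]
    _ = _ := by
        rw [integral_sub hi2 hi1, neg_sub]
        rfl

end Memory

/-! ### The memory forcing expressed through the history itself -/

section History

variable {α c t : ℝ}

/-- A primitive is (τ - σ)^α (t - τ)^(-α)/((t - σ) α Γ(α)), thanks to (t - τ) + (τ - σ) = t - σ. -/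
lemma integral_rpow_mul_fracKernel (hα₀ : 0 < α) {σ : ℝ} (hσ : σ < c) (ht : c < t) :
    ∫ τ, (if τ < c then 1 / (t - τ) ^ (1 + α) else 0) * fracKernel α (τ - σ) =
      (c - σ) ^ α / ((t - c) ^ α * (t - σ) * (α * Real.Gamma α)) := by
  have h1 := Real.Gamma_pos_of_pos hα₀
  have htσ : 0 < t - σ := by linarith
  have htc : 0 < t - c := sub_pos.2 ht
  have hpos : ∀ τ ∈ Icc σ c, 0 < t - τ := fun τ hτ => by linarith [hτ.2]
  set D : ℝ := (t - σ) * (α * Real.Gamma α)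
  have hD : 0 < D := by positivity
  have hderiv : ∀ τ ∈ Ioo σ c, HasDerivAt (fun τ => (τ - σ) ^ α * (t - τ) ^ (-α) / D)
      (1 / (t - τ) ^ (1 + α) * ((τ - σ) ^ (α - 1) / Real.Gamma α)) τ := by
    intro τ hτ
    have ha : 0 < τ - σ := sub_pos.2 hτ.1
    have hb := hpos τ (Ioo_subset_Icc_self hτ)
    refine (((hasDerivAt_sub_const_rpow (p := α) hτ.1).mul
      (hasDerivAt_const_sub_rpow (p := -α) (sub_pos.1 hb))).div_const D).congr_deriv ?_
    have e1 : (τ - σ) ^ α = (τ - σ) ^ (α - 1) * (τ - σ) := by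
      rw [← Real.rpow_add_one ha.ne']; ring_nf
    have e2 : (t - τ) ^ (-α) = (t - τ) ^ (-(1 + α)) * (t - τ) := by
      rw [← Real.rpow_add_one hb.ne']; ring_nf
    rw [show -α - 1 = -(1 + α) by ring, e2, e1, Real.rpow_neg hb.le]
    have := (Real.rpow_pos_of_pos hb (1 + α)).ne'
    simp only [D]
    field_simp
    ring
  have hcont : ContinuousOn (fun τ => (τ - σ) ^ α * (t - τ) ^ (-α) / D) (Icc σ c) := by
    refine ContinuousOn.div_const (ContinuousOn.mul ?_ ?_) D
    · exact ContinuousOn.rpow_const (by fun_prop) fun v _ => Or.inr hα₀.le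
    · exact ContinuousOn.rpow_const (by fun_prop) fun v hv => Or.inl (hpos v hv).ne'
  have hint := intervalIntegral.integrableOn_deriv_of_nonneg hcont hderiv fun τ hτ => by
    have ha : 0 < τ - σ := sub_pos.2 hτ.1
    have hb := hpos τ (Ioo_subset_Icc_self hτ)
    positivity
  have hF := intervalIntegral.integral_eq_sub_of_hasDerivAt_of_le hσ.le hcont hderiv
    ((intervalIntegrable_iff_integrableOn_Ioc_of_le hσ.le).2 hint)
  rw [intervalIntegral_eq_integral hσ.le (k := fun τ =>
    (if τ < c then 1 / (t - τ) ^ (1 + α) else 0) * fracKernel α (τ - σ))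
    (Filter.Eventually.of_forall fun τ hτ => ?_) fun τ hτ => ?_] at hF
  · rw [hF, sub_self, Real.zero_rpow hα₀.ne', Real.rpow_neg htc.le]
    simp only [D]
    field_simp
    ring
  · rw [if_pos hτ.2, fracKernel_of_pos _ (sub_pos.2 hτ.1)]
  · rcases le_or_gt τ σ with h | h
    · rw [fracKernel_of_nonpos _ (by linarith), mul_zero]
    · rw [if_neg fun h2 => hτ ⟨h, h2⟩, zero_mul]

variable {X : Type*} [NormedAddCommGroup X] [NormedSpace ℝ X] [CompleteSpace X]

/-- Fubini moves the history integral from w - w(a) = I^α φ onto φ, where it can be compared with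
the memory kernel. -/
lemma integral_rpow_smul_fracInt (hα₀ : 0 < α) (ht : c < t) {φ : ℝ → X} {M a : ℝ}
    (hφ : StronglyMeasurable φ) (hM : ∀ t, ‖φ t‖ ≤ M * fracKernel 1 (t - a))
    (hφ0 : ∀ t, c ≤ t → φ t = 0) :
    Integrable (fun σ => ((c - σ) ^ α / ((t - c) ^ α * (t - σ) * (α * Real.Gamma α))) • φ σ) ∧
    ∫ τ, (if τ < c then 1 / (t - τ) ^ (1 + α) else 0) • fracInt α φ τ =
      ∫ σ, ((c - σ) ^ α / ((t - c) ^ α * (t - σ) * (α * Real.Gamma α))) • φ σ := by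
  have htc : 0 < t - c := sub_pos.2 ht
  set k : ℝ → ℝ := fun τ => if τ < c then 1 / (t - τ) ^ (1 + α) else 0
  have hk : Measurable k := Measurable.ite measurableSet_Iio (by fun_prop) measurable_const
  have hkb : ∀ τ, ‖k τ‖ ≤ 1 / (t - c) ^ (1 + α) * fracKernel 1 (c - τ) := fun τ => by
    rcases le_or_gt c τ with h | h
    · simp [k, h.not_gt, fracKernel_of_nonpos 1 (sub_nonpos.2 h)]
    · have h2 : 0 < t - τ := by linarith
      have e : k τ = 1 / (t - τ) ^ (1 + α) := if_pos h
      rw [e, fracKernel_one, if_pos (sub_pos.2 h), mul_one, Real.norm_of_nonneg (by positivity)]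
      exact one_div_le_one_div_of_le (by positivity)
        (Real.rpow_le_rpow htc.le (by linarith) (by linarith))
  have hint : Integrable (Function.uncurry fun τ σ => k τ • fracKernel α (τ - σ) • φ σ)
      (volume.prod volume) := by
    refine integrable_prod_of_norm_le_fracKernel (γ := 1) (δ := α) (ε := 1) (s := a) (t := c)
      (C := 1 / (t - c) ^ (1 + α) * M) ?_ one_pos hα₀ one_pos fun τ σ => ?_
    · exact (hk.comp measurable_fst).stronglyMeasurable.smul
        ((Measurable.stronglyMeasurable (by fun_prop)).smul (hφ.comp_measurable measurable_snd))
    · rw [norm_smul]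
      refine (mul_le_mul (hkb τ) (norm_fracKernel_smul_le hα₀ (hM σ) _) (norm_nonneg _)
        (mul_nonneg (by positivity) (fracKernel_nonneg one_pos _))).trans (le_of_eq (by ring))
  have hinner : ∀ σ, ∫ τ, k τ • fracKernel α (τ - σ) • φ σ =
      ((c - σ) ^ α / ((t - c) ^ α * (t - σ) * (α * Real.Gamma α))) • φ σ := fun σ => by
    rcases le_or_gt c σ with hσ | hσ
    · simp [hφ0 σ hσ]
    · rw [← integral_rpow_mul_fracKernel hα₀ hσ ht, ← integral_smul_const]
      simp_rw [smul_smul, k]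
  refine ⟨?_, ?_⟩
  · have h := hint.integral_prod_right
    simpa only [Function.uncurry_apply_pair, hinner] using h
  · simp_rw [← hinner]
    rw [← integral_integral_swap hint]
    simp_rw [integral_smul]
    rfl

/-- The forcing produced by the history of `w`, in terms of `w` itself. -/
lemma memoryForcing_eq (hα₀ : 0 < α) (hα₁ : α < 1) {a : ℝ} (hac : a ≤ c) (ht : c < t)
    {φ w : ℝ → X} {M : ℝ} (hφ : StronglyMeasurable φ)
    (hM : ∀ t, ‖φ t‖ ≤ M * fracKernel 1 (t - a)) (hφ0 : ∀ t, c ≤ t → φ t = 0)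
    (hw : ∀ t ∈ Icc a c, w t - w a = fracInt α φ t) :
    (α / Real.Gamma (1 - α)) • (∫ τ in a..c, (1 / (t - τ) ^ (1 + α)) • (w τ - w a))
      - (1 / (Real.Gamma (1 - α) * (t - c) ^ α)) • (w c - w a) = memoryForcing α c φ t := by
  have h1 := Real.Gamma_pos_of_pos hα₀
  have h3 := Real.Gamma_pos_of_pos (show 0 < 1 - α by linarith)
  have htc : 0 < t - c := sub_pos.2 ht
  obtain ⟨hi, he⟩ := integral_rpow_smul_fracInt hα₀ ht hφ hM hφ0
  have hi2 := integrable_fracKernel_smul hα₀ one_pos hM hφ c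
  have hI : ∫ τ in a..c, (1 / (t - τ) ^ (1 + α)) • (w τ - w a) =
      ∫ τ, (if τ < c then 1 / (t - τ) ^ (1 + α) else 0) • fracInt α φ τ := by
    refine intervalIntegral_eq_integral hac (Filter.Eventually.of_forall fun τ hτ => ?_)
      fun τ hτ => ?_
    · rw [if_pos hτ.2, hw τ (Ioo_subset_Icc_self hτ)]
    · rcases le_or_gt τ a with h | h
      · rw [eq_zero_of_norm_le_mul_fracKernel (norm_fracInt_le hα₀ one_pos hM τ) h, smul_zero]
      · rw [if_neg fun h2 => hτ ⟨h, h2⟩, zero_smul]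
  have hi' : Integrable fun σ => (α / Real.Gamma (1 - α)) •
      ((c - σ) ^ α / ((t - c) ^ α * (t - σ) * (α * Real.Gamma α))) • φ σ := hi.smul _
  have hi2' : Integrable fun σ => (1 / (Real.Gamma (1 - α) * (t - c) ^ α)) •
      fracKernel α (c - σ) • φ σ := hi2.smul _
  rw [hI, he, hw c (right_mem_Icc.2 hac), fracInt, ← integral_smul, ← integral_smul,
    ← integral_sub hi' hi2', memoryForcing, ← integral_neg]
  refine integral_congr_ae (Filter.Eventually.of_forall fun σ => ?_)
  dsimp only
  rcases le_or_gt c σ with hσ | hσ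
  · simp [hφ0 σ hσ]
  · have hp : 0 < c - σ := sub_pos.2 hσ
    have hs : 0 < t - σ := by linarith
    rw [smul_smul, smul_smul, ← sub_smul, ← neg_smul, memoryKernel_of_lt hσ ht,
      fracKernel_of_pos α hp]
    congr 1
    -- The two kernels share the factor (c - σ)^(α-1)/(t - c)^α, and what remains is (c - σ)/(t - σ)
    -- - 1 = -(t - c)/(t - σ).
    have e1 : (c - σ) ^ α = (c - σ) ^ (α - 1) * (c - σ) := by
      rw [← Real.rpow_add_one hp.ne']; ring_nf
    have e2 : (t - c) ^ (1 - α) = (t - c) / (t - c) ^ α := by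
      rw [Real.rpow_sub htc, Real.rpow_one]
    have := (Real.rpow_pos_of_pos htc α).ne'
    rw [e1, e2]
    field_simp
    ring

end History

/-! ### Uniqueness for the Volterra equation -/

section CauchyProblem

variable {R : Type*} [NormedRing R] [NormedAlgebra ℝ R] [CompleteSpace R]
  {E : Type*} [NormedAddCommGroup E] [NormedSpace ℝ E] [CompleteSpace E]
  (L : R →L[ℝ] E →L[ℝ] E) {α t₀ tₛ ϑ : ℝ} {A : ℝ → R} {M : ℝ}

omit [CompleteSpace R] [CompleteSpace E] in
/-- If `A` vanishes to the right of `ϑ`, then `A z` is bounded for the resolvent solution `z`. -/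
lemma exists_norm_apply_resolventSol_le (hα₀ : 0 < α) (hα₁ : α < 1) (hAM : ∀ t, ‖A t‖ ≤ M)
    (hA0 : ∀ t, ϑ ≤ t → A t = 0) {f : ℝ → E} {C : ℝ}
    (hC : ∀ t, ‖f t‖ ≤ C * fracKernel 1 (t - tₛ)) :
    ∃ D, ∀ t, ‖L (A t) (resolventSol L α A f t)‖ ≤ D * fracKernel 1 (t - tₛ) := by
  have hM : 0 ≤ M := (norm_nonneg _).trans (hAM 0)
  obtain ⟨D, hD, h⟩ := exists_norm_resolventSol_le L hα₀ hα₁ hAM hC ϑ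
  set D' := (ϑ - tₛ) ^ (α + 1 - 1) * Real.Gamma 1 / Real.Gamma (α + 1)
  refine ⟨‖L‖ * M * (D * |D'|), fun t => ?_⟩
  have h0 := fracKernel_nonneg one_pos (t - tₛ)
  rcases le_or_gt ϑ t with ht | ht
  · rw [hA0 t ht, map_zero, zero_apply, norm_zero]
    positivity
  · have h1 : ‖resolventSol L α A f t‖ ≤ D * |D'| * fracKernel 1 (t - tₛ) := by
      refine (h t ht.le).trans ?_
      rw [mul_assoc]
      refine mul_le_mul_of_nonneg_left ?_ hD
      exact (fracKernel_le one_pos (by linarith) (by linarith)).trans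
        (mul_le_mul_of_nonneg_right (le_abs_self _) h0)
    refine ((L _).le_opNorm _).trans ?_
    rw [mul_assoc]
    exact mul_le_mul ((L.le_opNorm _).trans (mul_le_mul_of_nonneg_left (hAM t) (norm_nonneg L)))
      h1 (norm_nonneg _) (by positivity)

/-- Uniqueness for the Volterra equation `y = I^α (A y + f)`, in terms of `ψ = A y + f`. -/
lemma fracInt_eq_resolventSol (hα₀ : 0 < α) (hα₁ : α < 1) (hA : StronglyMeasurable A)
    (hAM : ∀ t, ‖A t‖ ≤ M) (hA0 : ∀ t, ϑ ≤ t → A t = 0)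
    (hL : ∀ a b v, L (a * b) v = L a (L b v)) (hL1 : ∀ v, L 1 v = v)
    {f ψ : ℝ → E} {C C' : ℝ} (hf : StronglyMeasurable f)
    (hC : ∀ t, ‖f t‖ ≤ C * fracKernel 1 (t - tₛ)) (hψ : StronglyMeasurable ψ)
    (hC' : ∀ t, ‖ψ t‖ ≤ C' * fracKernel 1 (t - tₛ))
    (heq : ∀ᵐ t, t ∈ Ioo tₛ ϑ → ψ t = L (A t) (fracInt α ψ t) + f t) {t : ℝ} (ht : t ≤ ϑ) :
    fracInt α ψ t = resolventSol L α A f t := by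
  have hM : 0 ≤ M := (norm_nonneg _).trans (hAM 0)
  set z := resolventSol L α A f
  have hz : StronglyMeasurable z := stronglyMeasurable_resolventSol L hα₀ hα₁ hA hAM hf
  obtain ⟨D, hD, hzb⟩ := exists_norm_resolventSol_le L hα₀ hα₁ hAM hC ϑ
  obtain ⟨D', hD'⟩ := exists_norm_apply_resolventSol_le L hα₀ hα₁ hAM hA0 hC
  have hy := stronglyMeasurable_fracInt α hψ
  have hyb := norm_fracInt_le hα₀ one_pos hC'
  -- B lowers the order α + 1, natural for I^α of a bounded function, to the order α that the
  -- Gronwall lemma expects.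
  set B := (ϑ - tₛ) ^ (α + 1 - α) * Real.Gamma α / Real.Gamma (α + 1)
  have hB : ∀ t ≤ ϑ, ‖fracInt α ψ t - z t‖ ≤ (|C'| + D) * B * fracKernel α (t - tₛ) := by
    intro t ht
    have h0 : 0 ≤ fracKernel (α + 1) (t - tₛ) := fracKernel_nonneg (by linarith) _
    have h1 : fracKernel (α + 1) (t - tₛ) ≤ B * fracKernel α (t - tₛ) :=
      fracKernel_le hα₀ (by linarith) (by linarith)
    calc ‖fracInt α ψ t - z t‖ ≤ C' * fracKernel (α + 1) (t - tₛ) +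
          D * fracKernel (α + 1) (t - tₛ) := (norm_sub_le _ _).trans (add_le_add (hyb t) (hzb t ht))
      _ ≤ (|C'| + D) * fracKernel (α + 1) (t - tₛ) := by
          rw [← add_mul]
          exact mul_le_mul_of_nonneg_right (add_le_add_left (le_abs_self C') D) h0
      _ ≤ (|C'| + D) * (B * fracKernel α (t - tₛ)) :=
          mul_le_mul_of_nonneg_left h1 (by positivity)
      _ = _ := by ring
  have hLAz : StronglyMeasurable fun t => L (A t) (z t) :=
    L.continuous₂.comp_stronglyMeasurable (hA.prodMk hz)
  refine sub_eq_zero.1 (norm_eq_zero.1 (eq_zero_of_le_fracKernel_integral hα₀ hα₁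
    (M := ‖L‖ * M) (u := fun t => ‖fracInt α ψ t - z t‖) (by positivity) (fun _ => norm_nonneg _)
    hB (fun t ht => ?_) ht))
  have hi1 := integrable_fracKernel_smul hα₀ one_pos hC' hψ t
  have hi2 : Integrable fun τ => fracKernel α (t - τ) • (L (A τ) (z τ) + f τ) :=
    integrable_fracKernel_smul (C := D' + C) hα₀ one_pos (fun τ => (norm_add_le _ _).trans
      ((add_le_add (hD' τ) (hC τ)).trans (le_of_eq (by ring)))) (hLAz.add hf) t
  have hi3 : Integrable fun τ => fracKernel α (t - τ) * ‖fracInt α ψ τ - z τ‖ := by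
    refine ((integrable_fracKernel_conv hα₀ hα₀ tₛ t).1.const_mul ((|C'| + D) * B)).mono'
      ((Measurable.stronglyMeasurable (by fun_prop)).mul (hy.sub hz).norm).aestronglyMeasurable
      (Filter.Eventually.of_forall fun τ => ?_)
    rcases le_or_gt t τ with hτ | hτ
    · simp [fracKernel_of_nonpos α (sub_nonpos.2 hτ)]
    · rw [norm_mul, norm_norm, Real.norm_of_nonneg (fracKernel_nonneg hα₀ _)]
      exact (mul_le_mul_of_nonneg_left (hB τ (by linarith)) (fracKernel_nonneg hα₀ _)).trans
        (le_of_eq (by ring))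
  have hzeq : z t = fracInt α (fun τ => L (A τ) (z τ) + f τ) t :=
    resolventSol_eq L hα₀ hα₁ hA hAM hf hC hL hL1 t
  rw [hzeq, fracInt, fracInt, ← integral_sub hi1 hi2, ← integral_const_mul]
  refine norm_integral_le_of_norm_le (hi3.const_mul _) ?_
  filter_upwards [heq] with τ hτ
  rw [← smul_sub, mul_left_comm]
  rcases le_or_gt t τ with h | h
  · simp [fracKernel_of_nonpos α (sub_nonpos.2 h)]
  refine norm_fracKernel_smul_le hα₀ ?_ _
  rcases le_or_gt τ tₛ with h2 | h2
  · rw [eq_zero_of_norm_le_mul_fracKernel (hC' τ) h2, eq_zero_of_norm_le_mul_fracKernel (hC τ) h2,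
      eq_zero_of_norm_le_mul_fracKernel (hD' τ) h2, add_zero, sub_zero, norm_zero]
    positivity
  · rw [hτ ⟨h2, h.trans_le ht⟩, add_sub_add_right_eq_sub, ← map_sub]
    refine ((L _).le_opNorm _).trans ?_
    gcongr
    exact (L.le_opNorm _).trans (mul_le_mul_of_nonneg_left (hAM τ) (norm_nonneg L))

end CauchyProblem

/-! ### Existence and resolvent form of Cauchy solutions -/

section CauchySolution

variable {R : Type*} [NormedRing R] [NormedAlgebra ℝ R] [CompleteSpace R]
  {E : Type*} [NormedAddCommGroup E] [NormedSpace ℝ E] [CompleteSpace E]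

omit [CompleteSpace E] in
lemma fracInt_add {γ : ℝ} (hγ : 0 < γ) {s s' C C' : ℝ} {φ ψ : ℝ → E} (hφ : StronglyMeasurable φ)
    (hψ : StronglyMeasurable ψ) (hC : ∀ t, ‖φ t‖ ≤ C * fracKernel 1 (t - s))
    (hC' : ∀ t, ‖ψ t‖ ≤ C' * fracKernel 1 (t - s')) (t : ℝ) :
    fracInt γ (fun τ => φ τ + ψ τ) t = fracInt γ φ t + fracInt γ ψ t := by
  rw [fracInt, fracInt, fracInt, ← integral_add (integrable_fracKernel_smul hγ one_pos hC hφ t)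
    (integrable_fracKernel_smul hγ one_pos hC' hψ t)]
  simp_rw [smul_add]

variable (L : R →L[ℝ] E →L[ℝ] E) {α t₀ tₛ ϑ : ℝ} {A : ℝ → R} {M Mφ Mβ : ℝ} {φ β w : ℝ → E}

/-- The forcing in the Volterra equation on `[tₛ, ϑ]` for `x - w(tₛ)`: the contributions of the
history density `φ`, of the constant `w(tₛ)`, and of the inhomogeneity `β`. -/
noncomputable def cauchyForcing (α tₛ ϑ : ℝ) (A : ℝ → R) (φ β : ℝ → E) (v : E) (t : ℝ) : E :=
  memoryForcing α tₛ φ t + (Ioo tₛ ϑ).indicator (fun t => L (A t) v + β t) t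

variable (hα₀ : 0 < α) (hα₁ : α < 1) (hA : StronglyMeasurable A) (hAM : ∀ t, ‖A t‖ ≤ M)
  (hA0 : ∀ t, ϑ ≤ t → A t = 0) (hφ : StronglyMeasurable φ) (hφM : ∀ t, ‖φ t‖ ≤ Mφ)
  (hφ0 : ∀ t ∉ Ioo t₀ tₛ, φ t = 0) (hβ : StronglyMeasurable β) (hβM : ∀ t, ‖β t‖ ≤ Mβ)

include hAM hβM in
omit [CompleteSpace R] [CompleteSpace E] in
lemma norm_indicator_forcing_le (v : E) (t : ℝ) :
    ‖(Ioo tₛ ϑ).indicator (fun t => L (A t) v + β t) t‖ ≤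
      (‖L‖ * M * ‖v‖ + Mβ) * fracKernel 1 (t - tₛ) := by
  have hM : 0 ≤ M := (norm_nonneg _).trans (hAM 0)
  have hMβ : 0 ≤ Mβ := (norm_nonneg _).trans (hβM 0)
  refine norm_le_mul_fracKernel_one (ψ := (Ioo tₛ ϑ).indicator fun t => L (A t) v + β t)
    (fun t => ?_) (fun t ht => indicator_of_notMem (fun h => ht.not_gt h.1) _) t
  by_cases h : t ∈ Ioo tₛ ϑ
  · rw [indicator_of_mem h]
    refine (norm_add_le _ _).trans (add_le_add (((L _).le_opNorm _).trans ?_) (hβM t))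
    gcongr
    exact (L.le_opNorm _).trans (mul_le_mul_of_nonneg_left (hAM t) (norm_nonneg L))
  · rw [indicator_of_notMem h, norm_zero]
    positivity

include hA hβ in
omit [CompleteSpace R] [CompleteSpace E] in
lemma stronglyMeasurable_indicator_forcing (v : E) :
    StronglyMeasurable ((Ioo tₛ ϑ).indicator (fun t => L (A t) v + β t)) :=
  ((L.continuous₂.comp_stronglyMeasurable (hA.prodMk stronglyMeasurable_const)).add hβ).indicator
    measurableSet_Ioo

include hA hφ hβ in
omit [CompleteSpace R] [CompleteSpace E] in
lemma stronglyMeasurable_cauchyForcing (v : E) :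
    StronglyMeasurable (cauchyForcing L α tₛ ϑ A φ β v) :=
  (stronglyMeasurable_memoryForcing hφ).add (stronglyMeasurable_indicator_forcing L hA hβ v)

include hα₀ hα₁ hAM hφM hβM in
omit [CompleteSpace R] [CompleteSpace E] in
lemma exists_norm_cauchyForcing_le (v : E) :
    ∃ C, ∀ t, ‖cauchyForcing L α tₛ ϑ A φ β v t‖ ≤ C * fracKernel 1 (t - tₛ) := by
  obtain ⟨C, -, hC⟩ := exists_norm_memoryForcing_le (c := tₛ) hα₀ hα₁ hφM
  refine ⟨C + (‖L‖ * M * ‖v‖ + Mβ), fun t => (norm_add_le _ _).trans ?_⟩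
  rw [add_mul]
  exact add_le_add (hC t) (norm_indicator_forcing_le L hAM hβM v t)

include hα₀ hα₁ hA hAM hA0 hφ hφM hφ0 hβ hβM in
/-- Existence for the Cauchy problem with prescribed history `w`. -/
lemma exists_cauchy_solution (hL : ∀ a b v, L (a * b) v = L a (L b v)) (hL1 : ∀ v, L 1 v = v)
    (htₛ : t₀ ≤ tₛ) (hw : ∀ t ∈ Icc t₀ tₛ, w t - w t₀ = fracInt α φ t) :
    ∃ x : ℝ → E, IsFracAC α t₀ ϑ x ∧ (∀ t ∈ Icc t₀ tₛ, x t = w t) ∧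
      ∀ᵐ t, t ∈ Ioo tₛ ϑ → HasCaputoDerivAt α t₀ x (L (A t) (x t) + β t) t := by
  set v := w tₛ
  set f := cauchyForcing L α tₛ ϑ A φ β v
  set z := resolventSol L α A f
  have hφb := norm_le_mul_fracKernel_one (a := t₀) hφM fun t ht => hφ0 t fun h => ht.not_gt h.1
  have hφ0' : ∀ t, tₛ ≤ t → φ t = 0 := fun t ht => hφ0 t fun h => ht.not_gt h.2
  have hf : StronglyMeasurable f := stronglyMeasurable_cauchyForcing L hA hφ hβ v
  obtain ⟨C, hC⟩ := exists_norm_cauchyForcing_le (φ := φ) (tₛ := tₛ) (ϑ := ϑ) L hα₀ hα₁ hAM hφM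
    hβM v
  obtain ⟨D, hD⟩ := exists_norm_apply_resolventSol_le L hα₀ hα₁ hAM hA0 hC
  obtain ⟨Ch, -, hCh⟩ := exists_norm_memoryForcing_le (c := tₛ) hα₀ hα₁ hφM
  have hz : StronglyMeasurable z := stronglyMeasurable_resolventSol L hα₀ hα₁ hA hAM hf
  have hLAz : StronglyMeasurable fun t => L (A t) (z t) :=
    L.continuous₂.comp_stronglyMeasurable (hA.prodMk hz)
  set k : ℝ → E := (Ioo tₛ ϑ).indicator fun t => L (A t) v + β t
  have hk : StronglyMeasurable k := stronglyMeasurable_indicator_forcing L hA hβ v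
  have hkb := norm_indicator_forcing_le (tₛ := tₛ) (ϑ := ϑ) L hAM hβM v
  set ψ₁ : ℝ → E := fun t => L (A t) (z t) + k t
  have hψ₁ : StronglyMeasurable ψ₁ := hLAz.add hk
  have hψ₁b : ∀ t, ‖ψ₁ t‖ ≤ (D + (‖L‖ * M * ‖v‖ + Mβ)) * fracKernel 1 (t - tₛ) := fun t =>
    (norm_add_le _ _).trans (by rw [add_mul]; exact add_le_add (hD t) (hkb t))
  -- In z = I^α(A z + f) the memory part of f integrates to the history increment, so w(tₛ) + z
  -- continues w with density φ + ψ₁.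
  have hzt : ∀ t, tₛ ≤ t → z t = fracInt α φ t - fracInt α φ tₛ + fracInt α ψ₁ t := by
    intro t ht
    rw [← fracInt_memoryForcing hα₀ hα₁ hφ hφb hφ0' ht, ← fracInt_add hα₀
      (stronglyMeasurable_memoryForcing hφ) hψ₁ hCh hψ₁b]
    refine (resolventSol_eq L hα₀ hα₁ hA hAM hf hC hL hL1 t).trans ?_
    congr 1
    ext τ
    exact add_left_comm _ _ _
  set ψ : ℝ → E := fun t => φ t + ψ₁ t
  have hψ : StronglyMeasurable ψ := hφ.add hψ₁
  set Cψ := Mφ + |D + (‖L‖ * M * ‖v‖ + Mβ)|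
  have hψM : ∀ t, ‖ψ t‖ ≤ Cψ := fun t => (norm_add_le _ _).trans
    (add_le_add (hφM t) (norm_le_of_norm_le_mul_fracKernel_one hψ₁b t))
  have hψ₁0 : ∀ t ≤ tₛ, ψ₁ t = 0 := fun t ht => eq_zero_of_norm_le_mul_fracKernel (hψ₁b t) ht
  have hψb := norm_le_mul_fracKernel_one (a := t₀) hψM fun t ht => by
    simp only [ψ]
    rw [hφ0 t fun h => ht.not_gt h.1, hψ₁0 t (ht.trans htₛ), add_zero]
  set x : ℝ → E := fun t => if t ≤ tₛ then w t else v + z t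
  have hx1 : ∀ t ≤ tₛ, x t = w t := fun t ht => if_pos ht
  have hx2 : ∀ t, tₛ < t → x t = v + z t := fun t ht => if_neg ht.not_ge
  have hxψ : ∀ t ∈ Icc t₀ ϑ, x t - x t₀ = fracInt α ψ t := by
    intro t ht
    rw [hx1 t₀ htₛ, fracInt_add hα₀ hφ hψ₁ hφb hψ₁b]
    rcases le_or_gt t tₛ with h | h
    · rw [hx1 t h, hw t ⟨ht.1, h⟩,
        eq_zero_of_norm_le_mul_fracKernel (norm_fracInt_le hα₀ one_pos hψ₁b t) h, add_zero]
    · rw [hx2 t h, hzt t h.le, ← hw tₛ ⟨htₛ, le_rfl⟩]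
      simp only [v]
      abel
  refine ⟨x, ⟨ψ, memLp_top_of_bound hψ.aestronglyMeasurable Cψ
    (Filter.Eventually.of_forall hψM), fun t ht => ?_⟩, fun t ht => hx1 t ht.2, ?_⟩
  · rw [rlIntegral_eq_fracInt (ψ := ψ) ht.1 (Filter.Eventually.of_forall fun _ _ => rfl)
      fun τ hτ => eq_zero_of_norm_le_mul_fracKernel (hψb τ) hτ, ← hxψ t ht, add_sub_cancel]
  · filter_upwards [ae_hasCaputoDerivAt hα₀ hα₁ hψ hψb hxψ] with t ht htm
    have h := ht ⟨htₛ.trans_lt htm.1, htm.2⟩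
    have e : ψ t = L (A t) (x t) + β t := by
      have ek : k t = L (A t) v + β t := indicator_of_mem htm _
      simp only [ψ, ψ₁]
      rw [hφ0' t htm.1.le, hx2 t htm.1, ek, map_add, zero_add]
      abel
    rwa [e] at h

include hα₀ hα₁ hA hAM hA0 hφ hφM hφ0 hβ hβM in
/-- The representation of a solution of the Cauchy problem by the resolvent kernel. -/
lemma cauchy_solution_eq (hL : ∀ a b v, L (a * b) v = L a (L b v)) (hL1 : ∀ v, L 1 v = v)
    (htₛ : t₀ ≤ tₛ) (hϑ : tₛ < ϑ) (hw : ∀ t ∈ Icc t₀ tₛ, w t - w t₀ = fracInt α φ t)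
    {x : ℝ → E} (hx : IsFracAC α t₀ ϑ x) (hxw : ∀ t ∈ Icc t₀ tₛ, x t = w t)
    (hxeq : ∀ᵐ t, t ∈ Ioo tₛ ϑ → HasCaputoDerivAt α t₀ x (L (A t) (x t) + β t) t)
    {t : ℝ} (ht : t ∈ Icc tₛ ϑ) :
    x t = w tₛ + resolventSol L α A (cauchyForcing L α tₛ ϑ A φ β (w tₛ)) t := by
  have hφb := norm_le_mul_fracKernel_one (a := t₀) hφM fun t ht => hφ0 t fun h => ht.not_gt h.1
  have hφ0' : ∀ t, tₛ ≤ t → φ t = 0 := fun t ht => hφ0 t fun h => ht.not_gt h.2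
  obtain ⟨χ, hχ, hxχ⟩ := hx
  obtain ⟨ψ, N, hN, hψ, hψN, hψ0, hχψ⟩ := hχ.exists_bounded
  have hψb := norm_le_mul_fracKernel_one (a := t₀) hψN fun t ht => hψ0 t fun h => ht.not_gt h.1
  have hxψ : ∀ t ∈ Icc t₀ ϑ, x t - x t₀ = fracInt α ψ t := fun t ht => by
    rw [hxχ t ht, add_sub_cancel_left]
    refine rlIntegral_eq_fracInt ht.1 ?_ fun τ hτ => hψ0 τ fun h => hτ.not_gt h.1
    filter_upwards [hχψ] with τ hτ hm using hτ ⟨hm.1, hm.2.trans_le ht.2⟩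
  -- The density ψ of the solution is cut at tₛ; the past part generates w and the future part
  -- carries the equation.
  set φ' : ℝ → E := (Iio tₛ).indicator ψ
  set ψ₁ : ℝ → E := (Ioi tₛ).indicator ψ
  have hφ' : StronglyMeasurable φ' := hψ.indicator measurableSet_Iio
  have hψ₁ : StronglyMeasurable ψ₁ := hψ.indicator measurableSet_Ioi
  have hφ'1 : ∀ t < tₛ, φ' t = ψ t := fun t ht => indicator_of_mem (mem_Iio.2 ht) _
  have hψ₁1 : ∀ t, tₛ < t → ψ₁ t = ψ t := fun t ht => indicator_of_mem (mem_Ioi.2 ht) _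
  have hψ₁0 : ∀ t ≤ tₛ, ψ₁ t = 0 := fun t ht =>
    indicator_of_notMem (fun h => ht.not_gt (mem_Ioi.1 h)) _
  have hφ'N : ∀ t, ‖φ' t‖ ≤ N := fun t => (norm_indicator_le_norm_self _ _).trans (hψN t)
  have hφ'b := norm_le_mul_fracKernel_one (a := t₀) hφ'N fun t ht =>
    indicator_apply_eq_zero.2 fun _ => hψ0 t fun h => ht.not_gt h.1
  have hφ'0 : ∀ t, tₛ ≤ t → φ' t = 0 := fun t ht => 
    indicator_of_notMem (fun h => ht.not_gt (mem_Iio.1 h)) _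
  have hψ₁b := norm_le_mul_fracKernel_one (ψ := ψ₁) (a := tₛ)
    (fun t => (norm_indicator_le_norm_self _ _).trans (hψN t))
    hψ₁0
  have hsplit : ∀ t, fracInt α ψ t = fracInt α φ' t + fracInt α ψ₁ t := fun t => by
    rw [← fracInt_add hα₀ hφ' hψ₁ hφ'b hψ₁b]
    refine integral_congr_ae ?_
    filter_upwards [compl_mem_ae_iff.2 ((Set.finite_singleton tₛ).measure_zero volume)] with τ hτ
    congr 1
    rcases lt_or_gt_of_ne hτ with h | h
    · rw [hφ'1 τ h, hψ₁0 τ h.le, add_zero]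
    · rw [hφ'0 τ h.le, hψ₁1 τ h, zero_add]
  have hψ₁z : ∀ t ≤ tₛ, fracInt α ψ₁ t = 0 := fun t ht =>
    eq_zero_of_norm_le_mul_fracKernel (norm_fracInt_le hα₀ one_pos hψ₁b t) ht
  have hw' : ∀ t ∈ Icc t₀ tₛ, w t - w t₀ = fracInt α φ' t := fun t ht => by
    rw [← hxw t ht, ← hxw t₀ ⟨le_rfl, htₛ⟩, hxψ t ⟨ht.1, ht.2.trans hϑ.le⟩, hsplit, hψ₁z t ht.2,
      add_zero]
  -- φ' and φ are both densities of w. The forcing depends on w alone by `memoryForcing_eq`, so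
  -- uniqueness of densities is not needed.
  have hmem : ∀ t, tₛ < t → memoryForcing α tₛ φ' t = memoryForcing α tₛ φ t := fun t ht => by
    rw [← memoryForcing_eq hα₀ hα₁ htₛ ht hφ hφb hφ0' hw,
      memoryForcing_eq hα₀ hα₁ htₛ ht hφ' hφ'b hφ'0 hw']
  obtain ⟨Ch, -, hCh⟩ := exists_norm_memoryForcing_le (c := tₛ) hα₀ hα₁ hφ'N
  -- ψ₂ is a density of x with respect to integration started at tₛ, the past being absorbed into
  -- the forcing.
  set ψ₂ : ℝ → E := fun t => memoryForcing α tₛ φ' t + ψ₁ t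
  have hψ₂ : StronglyMeasurable ψ₂ := (stronglyMeasurable_memoryForcing hφ').add hψ₁
  have hψ₂b : ∀ t, ‖ψ₂ t‖ ≤ (Ch + N) * fracKernel 1 (t - tₛ) := fun t =>
    (norm_add_le _ _).trans (by rw [add_mul]; exact add_le_add (hCh t) (hψ₁b t))
  have hxψ₂ : ∀ t ∈ Icc tₛ ϑ, x t = w tₛ + fracInt α ψ₂ t := fun t ht => by
    have h1 := hxψ t ⟨htₛ.trans ht.1, ht.2⟩
    have h2 := hw' tₛ ⟨htₛ, le_rfl⟩
    rw [hsplit, hxw t₀ ⟨le_rfl, htₛ⟩] at h1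
    rw [fracInt_add hα₀ (stronglyMeasurable_memoryForcing hφ') hψ₁ hCh hψ₁b,
      fracInt_memoryForcing hα₀ hα₁ hφ' hφ'b hφ'0 ht.1, ← h2, sub_eq_iff_eq_add.1 h1]
    abel
  obtain ⟨C, hC⟩ := exists_norm_cauchyForcing_le (φ := φ) (tₛ := tₛ) (ϑ := ϑ) L hα₀ hα₁ hAM hφM
    hβM (w tₛ)
  rw [hxψ₂ t ht, fracInt_eq_resolventSol (tₛ := tₛ) L hα₀ hα₁ hA hAM hA0 hL hL1
    (stronglyMeasurable_cauchyForcing L hA hφ hβ (w tₛ)) hC hψ₂ hψ₂b ?_ ht.2]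
  filter_upwards [ae_hasCaputoDerivAt hα₀ hα₁ hψ hψb hxψ, hxeq] with t ht1 ht2 htm
  have h := (ht1 ⟨htₛ.trans_lt htm.1, htm.2⟩).unique (ht2 htm)
  have e1 := hψ₁1 t htm.1
  have e2 : cauchyForcing L α tₛ ϑ A φ β (w tₛ) t =
      memoryForcing α tₛ φ t + (L (A t) (w tₛ) + β t) := by
    rw [cauchyForcing, indicator_of_mem htm]
  rw [hxψ₂ t (Ioo_subset_Icc_self htm), map_add] at h
  simp only [ψ₂] at h ⊢
  rw [e1, e2, hmem t htm.1, h]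
  abel

end CauchySolution

/-! ### Fundamental solutions in a normed algebra and the representation formula -/

section FundamentalSolution

variable {R : Type*} [NormedRing R] [NormedAlgebra ℝ R]

/-- The analogue of `IsFundamentalMatrix` in a normed algebra. -/
def IsFundamentalSolution (α t₀ ϑ : ℝ) (A : ℝ → R) (F : ℝ → ℝ → R) : Prop :=
  ∀ s ∈ Icc t₀ ϑ, IsCont s ϑ (fun t => F t s) ∧
    ∀ t ∈ Icc s ϑ, F t s = (1 / Real.Gamma α) • (1 : R) + ((t - s) ^ (1 - α) / Real.Gamma α) •
      ∫ τ in s..t, ((t - τ) ^ (α - 1) * (τ - s) ^ (α - 1)) • (A τ * F τ s)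

variable {α t₀ ϑ M : ℝ} {A A' : ℝ → R} {F F' : ℝ → ℝ → R}

lemma IsFundamentalSolution.congr (h : IsFundamentalSolution α t₀ ϑ A F)
    (hAA' : ∀ᵐ t, t ∈ Ioo t₀ ϑ → A t = A' t) : IsFundamentalSolution α t₀ ϑ A' F := by
  refine fun s hs => ⟨(h s hs).1, fun t ht => ?_⟩
  rw [(h s hs).2 t ht, intervalIntegral.integral_of_le ht.1, intervalIntegral.integral_of_le ht.1,
    integral_Ioc_eq_integral_Ioo, integral_Ioc_eq_integral_Ioo]
  congr 2
  refine setIntegral_congr_ae measurableSet_Ioo ?_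
  filter_upwards [hAA'] with τ hτ hm
  rw [hτ ⟨hs.1.trans_lt hm.1, hm.2.trans_le ht.2⟩]

lemma resolventKernel_of_le (hα₀ : 0 < α) (hα₁ : α < 1) (hAM : ∀ t, ‖A t‖ ≤ M) {t s : ℝ}
    (hts : t ≤ s) : resolventKernel α A t s = 0 := by
  obtain ⟨_, _, h⟩ := exists_norm_resolventKernel_le (A := A) hα₀ hα₁ hAM (t - s)
  exact eq_zero_of_norm_le_mul_fracKernel (h t s le_rfl) hts

variable [CompleteSpace R]

lemma IsFundamentalSolution.rpow_smul_eq (hα₀ : 0 < α) (hα₁ : α < 1) (hA : StronglyMeasurable A)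
    (hAM : ∀ t, ‖A t‖ ≤ M) (h : IsFundamentalSolution α t₀ ϑ A F) {s t : ℝ} (hs : t₀ ≤ s)
    (hst : s < t) (ht : t ≤ ϑ) : (t - s) ^ (α - 1) • F t s = resolventKernel α A t s := by
  obtain ⟨h1, h2⟩ := h s ⟨hs, hst.le.trans ht⟩
  exact rpow_smul_eq_resolventKernel hα₀ hα₁ hA hAM (hst.le.trans ht) h1 h2 ⟨hst, ht⟩

theorem exists_isFundamentalSolution (hα₀ : 0 < α) (hα₁ : α < 1) (hA : IsLinf t₀ ϑ A) :
    ∃ F, IsFundamentalSolution α t₀ ϑ A F := by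
  obtain ⟨A', M, -, hA', hAM, -, hAA'⟩ := hA.exists_bounded
  have h : IsFundamentalSolution α t₀ ϑ A' (fundSol α A') := fun s _ =>
    ⟨continuousOn_fundSol hα₀ hα₁ hA' hAM s ϑ, fun t ht => fundSol_eq hα₀ hα₁ hA' hAM ht.1⟩
  refine ⟨_, h.congr ?_⟩
  filter_upwards [hAA'] with t ht hm using (ht hm).symm

theorem IsFundamentalSolution.eq_of_mem (hα₀ : 0 < α) (hα₁ : α < 1) (hA : IsLinf t₀ ϑ A)
    (hF : IsFundamentalSolution α t₀ ϑ A F) (hF' : IsFundamentalSolution α t₀ ϑ A F') {s t : ℝ}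
    (hs : s ∈ Icc t₀ ϑ) (ht : t ∈ Icc s ϑ) : F' t s = F t s := by
  obtain ⟨A', M, -, hA', hAM, -, hAA'⟩ := hA.exists_bounded
  -- On the diagonal the power (t - s)^(α-1) is 0 by convention and loses F(s, s); there the
  -- defining equation gives Id/Γ(α) directly.
  rcases ht.1.eq_or_lt with rfl | hst
  · rw [(hF s hs).2 s ht, (hF' s hs).2 s ht, intervalIntegral.integral_same,
      intervalIntegral.integral_same]
  · have e := ((hF'.congr hAA').rpow_smul_eq hα₀ hα₁ hA' hAM hs.1 hst ht.2).trans
      ((hF.congr hAA').rpow_smul_eq hα₀ hα₁ hA' hAM hs.1 hst ht.2).symm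
    exact smul_right_injective R (Real.rpow_pos_of_pos (sub_pos.2 hst) _).ne' e

variable {E : Type*} [NormedAddCommGroup E] [NormedSpace ℝ E] [CompleteSpace E]
  (L : R →L[ℝ] E →L[ℝ] E) {tₛ Mφ Mβ : ℝ} {φ β b : ℝ → E}

/-- The resolvent solution of the Cauchy problem in terms of a fundamental solution. -/
lemma IsFundamentalSolution.resolventSol_cauchyForcing (hα₀ : 0 < α) (hα₁ : α < 1)
    (hA : StronglyMeasurable A) (hAM : ∀ t, ‖A t‖ ≤ M) (hφ : StronglyMeasurable φ)
    (hφM : ∀ t, ‖φ t‖ ≤ Mφ) (hβ : StronglyMeasurable β) (hβM : ∀ t, ‖β t‖ ≤ Mβ)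
    (hL : ∀ a b v, L (a * b) v = L a (L b v)) (hF : IsFundamentalSolution α t₀ ϑ A F)
    (htₛ : t₀ ≤ tₛ) (hAA' : ∀ᵐ t, t ∈ Ioo tₛ ϑ → A' t = A t)
    (hb : ∀ᵐ t, t ∈ Ioo tₛ ϑ → b t = memoryForcing α tₛ φ t + β t) (v : E) {t : ℝ}
    (ht : t ∈ Icc tₛ ϑ) :
    IsInt tₛ t (fun τ => (t - τ) ^ (α - 1) • (F t τ * A' τ)) ∧
      IsInt tₛ t (fun τ => (t - τ) ^ (α - 1) • L (F t τ) (b τ)) ∧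
      resolventSol L α A (cauchyForcing L α tₛ ϑ A φ β v) t =
        L (∫ τ in tₛ..t, (t - τ) ^ (α - 1) • (F t τ * A' τ)) v +
          ∫ τ in tₛ..t, (t - τ) ^ (α - 1) • L (F t τ) (b τ) := by
  set B : ℝ → R := (Ioo tₛ ϑ).indicator A
  have hB : StronglyMeasurable B := hA.indicator measurableSet_Ioo
  have hB1 : ∀ t ∈ Ioo tₛ ϑ, B t = A t := fun t ht => indicator_of_mem ht _
  have hB0 : ∀ t ∉ Ioo tₛ ϑ, B t = 0 := fun t ht => indicator_of_notMem ht _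
  have hBb := norm_le_mul_fracKernel_one (ψ := B) (a := tₛ)
    (fun t => (norm_indicator_le_norm_self _ _).trans (hAM t))
    fun t ht => hB0 t fun h => ht.not_gt h.1
  set g : ℝ → E := fun t => memoryForcing α tₛ φ t + (Ioo tₛ ϑ).indicator β t
  have hg : StronglyMeasurable g :=
    (stronglyMeasurable_memoryForcing hφ).add (hβ.indicator measurableSet_Ioo)
  have hg1 : ∀ t ∈ Ioo tₛ ϑ, g t = memoryForcing α tₛ φ t + β t := fun t ht => by
    simp only [g]
    rw [indicator_of_mem ht]
  obtain ⟨C, -, hC⟩ := exists_norm_memoryForcing_le (c := tₛ) hα₀ hα₁ hφM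
  have hgb : ∀ t, ‖g t‖ ≤ (C + Mβ) * fracKernel 1 (t - tₛ) := fun t => by
    rw [add_mul]
    refine (norm_add_le _ _).trans (add_le_add (hC t)
      (norm_le_mul_fracKernel_one (ψ := (Ioo tₛ ϑ).indicator β)
        (fun t => (norm_indicator_le_norm_self _ _).trans (hβM t))
        (fun t ht => indicator_of_notMem (fun h => ht.not_gt h.1) _) t))
  -- The general lemma is applied to the algebra acting on itself by left multiplication.
  have hi1 : Integrable fun τ => resolventKernel α A t τ * B τ :=
    integrable_resolventKernel_apply (ContinuousLinearMap.mul ℝ R) hα₀ hα₁ hA hAM hB hBb t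
  have hi2 : Integrable fun τ => L (resolventKernel α A t τ) (g τ) :=
    integrable_resolventKernel_apply L hα₀ hα₁ hA hAM hg hgb t
  have hG : ∀ τ ∈ Ioo tₛ t, (t - τ) ^ (α - 1) • F t τ = resolventKernel α A t τ := fun τ hτ =>
    hF.rpow_smul_eq hα₀ hα₁ hA hAM (htₛ.trans hτ.1.le) hτ.2 ht.2
  have he1 : ∀ᵐ τ, τ ∈ Ioo tₛ t →
      (t - τ) ^ (α - 1) • (F t τ * A' τ) = resolventKernel α A t τ * B τ := by
    filter_upwards [hAA'] with τ hτ hm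
    have hm' : τ ∈ Ioo tₛ ϑ := ⟨hm.1, hm.2.trans_le ht.2⟩
    rw [← smul_mul_assoc, hG τ hm, hτ hm', hB1 τ hm']
  have he2 : ∀ᵐ τ, τ ∈ Ioo tₛ t →
      (t - τ) ^ (α - 1) • L (F t τ) (b τ) = L (resolventKernel α A t τ) (g τ) := by
    filter_upwards [hb] with τ hτ hm
    have hm' : τ ∈ Ioo tₛ ϑ := ⟨hm.1, hm.2.trans_le ht.2⟩
    rw [← smul_apply, ← map_smul, hG τ hm, hτ hm', hg1 τ hm']
  have hz1 : ∀ τ ∉ Ioo tₛ t, resolventKernel α A t τ * B τ = 0 := fun τ hτ => by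
    rcases le_or_gt τ tₛ with h | h
    · rw [hB0 τ fun h' => h.not_gt h'.1, mul_zero]
    · rw [resolventKernel_of_le hα₀ hα₁ hAM (not_lt.1 fun h2 => hτ ⟨h, h2⟩), zero_mul]
  have hz2 : ∀ τ ∉ Ioo tₛ t, L (resolventKernel α A t τ) (g τ) = 0 := fun τ hτ => by
    rcases le_or_gt τ tₛ with h | h
    · rw [eq_zero_of_norm_le_mul_fracKernel (hgb τ) h, map_zero]
    · rw [resolventKernel_of_le hα₀ hα₁ hAM (not_lt.1 fun h2 => hτ ⟨h, h2⟩), map_zero, zero_apply]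
  refine ⟨intervalIntegrable_of_integrable ht.1 he1 hi1,
    intervalIntegrable_of_integrable ht.1 he2 hi2, ?_⟩
  rw [intervalIntegral_eq_integral ht.1 he1 hz1, intervalIntegral_eq_integral ht.1 he2 hz2]
  have e : L (∫ τ, resolventKernel α A t τ * B τ) v =
      ∫ τ, L (resolventKernel α A t τ * B τ) v :=
    ((L.flip v).integral_comp_comm hi1).symm
  have hi3 : Integrable fun τ => L (resolventKernel α A t τ * B τ) v :=
    (L.flip v).integrable_comp hi1
  rw [e, ← integral_add hi3 hi2]
  refine integral_congr_ae (Filter.Eventually.of_forall fun τ => ?_)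
  dsimp only
  rw [hL, ← map_add]
  congr 1
  simp only [cauchyForcing, g]
  by_cases h : τ ∈ Ioo tₛ ϑ
  · rw [indicator_of_mem h, indicator_of_mem h, hB1 τ h]
    abel
  · rw [indicator_of_notMem h, indicator_of_notMem h, hB0 τ h, map_zero, zero_apply]
    abel

end FundamentalSolution

/-! ### Specialisation to matrices acting on vectors -/

section Matrices

variable {n : ℕ}

/-- The action of matrices on vectors as a continuous bilinear map. -/
noncomputable def mulVecCLM (n : ℕ) :
    Matrix (Fin n) (Fin n) ℝ →L[ℝ] (Fin n → ℝ) →L[ℝ] (Fin n → ℝ) :=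
  LinearMap.mkContinuous₂ (Matrix.mulVecBilin ℝ ℝ) 1 fun A v => by
    rw [one_mul]
    exact Matrix.linfty_opNorm_mulVec A v

lemma ae_restrict_Icc_iff {a b : ℝ} {p : ℝ → Prop} :
    (∀ᵐ t ∂(volume.restrict (Icc a b)), p t) ↔ ∀ᵐ t, t ∈ Ioo a b → p t := by
  rw [← Measure.restrict_congr_set Ioo_ae_eq_Icc, ae_restrict_iff' measurableSet_Ioo]

end Matrices

section LinearSystem

attribute [local instance] Matrix.linftyOpNormedRing Matrix.linftyOpNormedAlgebra

variable {n : ℕ} {α t₀ tₛ ϑ : ℝ} {A : ℝ → Matrix (Fin n) (Fin n) ℝ} {b w x : ℝ → Fin n → ℝ}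
  {F F' : ℝ → ℝ → Matrix (Fin n) (Fin n) ℝ}

lemma exists_isFundamentalMatrix (hα₀ : 0 < α) (hα₁ : α < 1) (hA : IsLinf t₀ ϑ A) :
    ∃ F, IsFundamentalMatrix α t₀ ϑ A F :=
  exists_isFundamentalSolution hα₀ hα₁ hA

lemma IsFundamentalMatrix.eq_of_mem (hF : IsFundamentalMatrix α t₀ ϑ A F) (hα₀ : 0 < α)
    (hα₁ : α < 1) (hA : IsLinf t₀ ϑ A) (hF' : IsFundamentalMatrix α t₀ ϑ A F') {s t : ℝ}
    (hs : s ∈ Icc t₀ ϑ) (ht : t ∈ Icc s ϑ) : F' t s = F t s :=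
  IsFundamentalSolution.eq_of_mem hα₀ hα₁ hA hF hF' hs ht

lemma IsFracAC.exists_bounded {X : Type*} [NormedAddCommGroup X] [NormedSpace ℝ X] {w : ℝ → X}
    {a b : ℝ} (h : IsFracAC α a b w) : ∃ (φ : ℝ → X) (M : ℝ), StronglyMeasurable φ ∧
      (∀ t, ‖φ t‖ ≤ M) ∧ (∀ t ∉ Ioo a b, φ t = 0) ∧ ∀ t ∈ Icc a b, w t - w a = fracInt α φ t := by
  obtain ⟨χ, hχ, hw⟩ := h
  obtain ⟨φ, M, -, hφ, hM, h0, hχφ⟩ := hχ.exists_bounded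
  refine ⟨φ, M, hφ, hM, h0, fun t ht => ?_⟩
  rw [hw t ht, add_sub_cancel_left]
  refine rlIntegral_eq_fracInt ht.1 ?_ fun τ hτ => h0 τ fun h => hτ.not_gt h.1
  filter_upwards [hχφ] with τ hτ hm using hτ ⟨hm.1, hm.2.trans_le ht.2⟩

lemma mulVecCLM_mul (B C : Matrix (Fin n) (Fin n) ℝ) (v : Fin n → ℝ) :
    mulVecCLM n (B * C) v = mulVecCLM n B (mulVecCLM n C v) :=
  (Matrix.mulVec_mulVec v B C).symm

lemma mulVecCLM_one (v : Fin n → ℝ) : mulVecCLM n 1 v = v := Matrix.one_mulVec v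

lemma exists_isSolution (hα₀ : 0 < α) (hα₁ : α < 1) (htₛ : t₀ ≤ tₛ) (hA : IsLinf t₀ ϑ A)
    (hb : IsLinf t₀ ϑ b) (hw : IsFracAC α t₀ tₛ w) : ∃ x, IsSolution α t₀ tₛ ϑ A b w x := by
  obtain ⟨A', M, -, hA', hAM, hA0, hAA'⟩ := IsLinf.exists_bounded (X := Matrix (Fin n) (Fin n) ℝ) hA
  obtain ⟨β, Mβ, -, hβ, hβM, -, hbβ⟩ := hb.exists_bounded
  obtain ⟨φ, Mφ, hφ, hφM, hφ0, hwφ⟩ := hw.exists_bounded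
  obtain ⟨x, hx, hxw, hxeq⟩ := exists_cauchy_solution (mulVecCLM n) hα₀ hα₁ hA' hAM
    (fun t ht => hA0 t fun h => ht.not_gt h.2) hφ hφM hφ0 hβ hβM mulVecCLM_mul mulVecCLM_one htₛ hwφ
  refine ⟨x, hx, hxw, ae_restrict_Icc_iff.2 ?_⟩
  filter_upwards [hxeq, hAA', hbβ] with t h1 h2 h3 hm
  have hm' : t ∈ Ioo t₀ ϑ := ⟨htₛ.trans_lt hm.1, hm.2⟩
  rw [h2 hm', h3 hm']
  exact h1 hm

/-- After passing to bounded representatives of A, b and the density of w, b_* is almost everywhere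
the memory forcing plus b. Both x and F are arbitrary here, so the formula also yields uniqueness of
x. -/
lemma IsSolution.representation (hx : IsSolution α t₀ tₛ ϑ A b w x) (hα₀ : 0 < α) (hα₁ : α < 1)
    (htₛ : t₀ ≤ tₛ) (hϑ : tₛ < ϑ) (hA : IsLinf t₀ ϑ A) (hb : IsLinf t₀ ϑ b)
    (hw : IsFracAC α t₀ tₛ w) (hF : IsFundamentalMatrix α t₀ ϑ A F) {t : ℝ} (ht : t ∈ Icc tₛ ϑ) :
    IsInt tₛ t (fun τ => (t - τ) ^ (α - 1) • (F t τ * A τ)) ∧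
      IsInt tₛ t (fun τ => (t - τ) ^ (α - 1) • (F t τ *ᵥ bStar α t₀ tₛ w b τ)) ∧
      x t = (1 + ∫ τ in tₛ..t, (t - τ) ^ (α - 1) • (F t τ * A τ)) *ᵥ w tₛ
        + ∫ τ in tₛ..t, (t - τ) ^ (α - 1) • (F t τ *ᵥ bStar α t₀ tₛ w b τ) := by
  obtain ⟨A', M, -, hA', hAM, hA0, hAA'⟩ := IsLinf.exists_bounded (X := Matrix (Fin n) (Fin n) ℝ) hA
  obtain ⟨β, Mβ, -, hβ, hβM, -, hbβ⟩ := hb.exists_bounded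
  obtain ⟨φ, Mφ, hφ, hφM, hφ0, hwφ⟩ := hw.exists_bounded
  have hφb := norm_le_mul_fracKernel_one (a := t₀) hφM fun t ht => hφ0 t fun h => ht.not_gt h.1
  have hbs : ∀ᵐ t, t ∈ Ioo tₛ ϑ → bStar α t₀ tₛ w b t = memoryForcing α tₛ φ t + β t := by
    filter_upwards [hbβ] with t h hm
    rw [bStar, h ⟨htₛ.trans_lt hm.1, hm.2⟩, memoryForcing_eq hα₀ hα₁ htₛ hm.1 hφ hφb
      (fun t ht => hφ0 t fun h => ht.not_gt h.2) hwφ]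
  have hxeq : ∀ᵐ t, t ∈ Ioo tₛ ϑ → HasCaputoDerivAt α t₀ x (mulVecCLM n (A' t) (x t) + β t) t := by
    filter_upwards [ae_restrict_Icc_iff.1 hx.equation, hAA', hbβ] with t h1 h2 h3 hm
    have hm' : t ∈ Ioo t₀ ϑ := ⟨htₛ.trans_lt hm.1, hm.2⟩
    rw [← h2 hm', ← h3 hm']
    exact h1 hm
  have hAA : ∀ᵐ t, t ∈ Ioo tₛ ϑ → A t = A' t := by
    filter_upwards [hAA'] with t h hm using h ⟨htₛ.trans_lt hm.1, hm.2⟩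
  obtain ⟨h1, h2, h3⟩ := IsFundamentalSolution.resolventSol_cauchyForcing (mulVecCLM n) hα₀ hα₁ hA'
    hAM hφ hφM hβ hβM mulVecCLM_mul (IsFundamentalSolution.congr hF hAA') htₛ hAA hbs (w tₛ) ht
  refine ⟨h1, h2, ?_⟩
  rw [cauchy_solution_eq (mulVecCLM n) hα₀ hα₁ hA' hAM (fun t ht => hA0 t fun h => ht.not_gt h.2)
    hφ hφM hφ0 hβ hβM mulVecCLM_mul mulVecCLM_one htₛ hϑ hwφ hx.fracAC hx.initial hxeq ht, h3,
    Matrix.add_mulVec, Matrix.one_mulVec, add_assoc]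
  rfl

end LinearSystem

end CaputoLinear

theorem theorem4p3 {n : ℕ} (α : ℝ) (hα₀ : 0 < α) (hα₁ : α < 1)
    (t₀ tₛ ϑ : ℝ) (htₛ : t₀ ≤ tₛ) (hϑ : tₛ < ϑ)
    (A : ℝ → Matrix (Fin n) (Fin n) ℝ) (hA : CaputoLinear.IsLinf t₀ ϑ A)
    (b : ℝ → Fin n → ℝ) (hb : CaputoLinear.IsLinf t₀ ϑ b)
    (w : ℝ → Fin n → ℝ) (hw : CaputoLinear.IsFracAC α t₀ tₛ w) :
    -- the fundamental matrix exists and is unique on `t₀ ≤ s ≤ t ≤ ϑ`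
    (∃ F, CaputoLinear.IsFundamentalMatrix α t₀ ϑ A F ∧
      ∀ F', CaputoLinear.IsFundamentalMatrix α t₀ ϑ A F' →
        ∀ s ∈ Icc t₀ ϑ, ∀ t ∈ Icc s ϑ, F' t s = F t s) ∧
    -- the solution exists and is unique on `[t₀, ϑ]`
    (∃ x, CaputoLinear.IsSolution α t₀ tₛ ϑ A b w x ∧
      ∀ x', CaputoLinear.IsSolution α t₀ tₛ ϑ A b w x' → ∀ t ∈ Icc t₀ ϑ, x' t = x t) ∧
    -- the representation formula, with convergent integrals
    ∀ (F : ℝ → ℝ → Matrix (Fin n) (Fin n) ℝ) (x : ℝ → Fin n → ℝ),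
      CaputoLinear.IsFundamentalMatrix α t₀ ϑ A F →
      CaputoLinear.IsSolution α t₀ tₛ ϑ A b w x →
      ∀ t ∈ Icc tₛ ϑ,
        CaputoLinear.IsInt tₛ t (fun τ => (t - τ) ^ (α - 1) • (F t τ * A τ)) ∧
        CaputoLinear.IsInt tₛ t
          (fun τ => (t - τ) ^ (α - 1) • (F t τ *ᵥ CaputoLinear.bStar α t₀ tₛ w b τ)) ∧
        x t = (1 + ∫ τ in tₛ..t, (t - τ) ^ (α - 1) • (F t τ * A τ)) *ᵥ w tₛ
          + ∫ τ in tₛ..t, (t - τ) ^ (α - 1) • (F t τ *ᵥ CaputoLinear.bStar α t₀ tₛ w b τ) := by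
  obtain ⟨F₀, hF₀⟩ := CaputoLinear.exists_isFundamentalMatrix (A := A) hα₀ hα₁ hA
  obtain ⟨x₀, hx₀⟩ := CaputoLinear.exists_isSolution hα₀ hα₁ htₛ hA hb hw
  refine ⟨⟨F₀, hF₀, fun F' hF' s hs t ht => hF₀.eq_of_mem hα₀ hα₁ hA hF' hs ht⟩,
    ⟨x₀, hx₀, fun x' hx' t ht => ?_⟩, fun F x hF hx t ht =>
    hx.representation hα₀ hα₁ htₛ hϑ hA hb hw hF ht⟩
  -- Up to tₛ both solutions are the history; afterwards both are given by the formula with the same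
  -- F₀.
  rcases le_or_gt t tₛ with h | h
  · rw [hx'.initial t ⟨ht.1, h⟩, hx₀.initial t ⟨ht.1, h⟩]
  · rw [(hx'.representation hα₀ hα₁ htₛ hϑ hA hb hw hF₀ ⟨h.le, ht.2⟩).2.2,
      (hx₀.representation hα₀ hα₁ htₛ hϑ hA hb hw hF₀ ⟨h.le, ht.2⟩).2.2]
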